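/- Let $\mathbb{D}$ be the open unit disk in $\mathbb{C}$ and for $z\in\mathbb{D}$ put $\phi(z)=\frac{1}{1-|z|}$. For an algebraic number $\alpha$ with minimal polynomial $P$ over the integers (primitive, with leading coefficient $A>0$), let $H(\alpha)=\left(A\prod_{P(z)=0}\max\{1,|z|\}\right)^{1/\deg P}$ be its absolute multiplicative height, the product being over the complex roots of $P$ with multiplicity. (1) Suppose that $f$ is analytic on $\mathbb{D}$ and that there are positive reals $a,b,c_0$ with $b>1$ such that $|f(z)|\le \phi(z)^{c_0\phi(z)}$ for $1/2\le |z|<1$ and $|f(x)|\ge a\,b^{\phi(x)}$ for all $x\in(0,1)$. Then there is a positive constant $c$, depending only on $a,b,c_0$ and effectively computable from them, such that for every real $H\ge e$ the set of rationals $q\in(0,1)$ such that $f(q)$ is also rational and $H(q),H(f(q))\le H$ is finite, with at most $$c(\log H)^{18}$$ elements. (2) For every $c_0>0$ there is a positive constant $c$, depending only on $c_0$ and effectively computable from it, with the following property. Let $S$ be a set with $(0,1)\subset S\subset\mathbb{D}$, let $f$ be analytic on $\mathbb{D}$, and let $a,b$ be reals with $b>1$ and $a\ge\max\{b^e,e\}$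 such that $|f(z)|\le \phi(z)^{c_0\phi(z)}$ for $1/2\le|z|<1$ and $|f(z)|\ge a\,b^{\phi(z)}$ for all $z\in S$. Put $l=\frac{\log a}{\log b}$. Then for every integer $d\ge 2$ and every real $H\ge e^e$ the set of algebraic $\alpha\in S$ such that $f(\alpha)$ is algebraic, $[\mathbb{Q}(\alpha,f(\alpha)):\mathbb{Q}]\le d$ and $H(\alpha),H(f(\alpha))\le H$ is finite, with at most $$c\,l^{17}(\log l)^9\,d^{18}(\log d)^9(\log H)^{17}(\log\log H)^6$$ elements. Here "effectively computable" means that $c$ can be taken to be $C(N)$ for a computable function $C:\mathbb{N}\to\mathbb{N}$ that does not depend on any of the data (one such function for each part), where $N$ is any natural number with $N\ge c_0$ and, in part (1), also $N\ge 1/a$ and $N\ge 1/(b-1)$. -/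

import Mathlib

open Polynomial

noncomputable section

/-- `φ(z) = 1 / (1 - |z|)`; it is only used for `|z| < 1`. -/
def diskPhi (z : ℂ) : ℝ := 1 / (1 - ‖z‖)

/-- The minimal polynomial over the integers of an algebraic number `α`: the primitive integer
polynomial that is a nonzero rational multiple of the monic minimal polynomial of `α` over `ℚ`.
It is determined up to sign, and the height below does not depend on the sign. -/
def intMinpoly (α : ℂ) : ℤ[X] :=
  (IsLocalization.integerNormalization (nonZeroDivisors ℤ) (minpoly ℚ α)).primPart

/-- The absolute multiplicative height of an algebraic number `α`:
`(|a| * ∏ max {1, |z|}) ^ (1 / deg P)`, where `P` is the minimal polynomial of `α` over the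
integers, `a` is its leading coefficient, and `z` runs over the complex roots of `P`. -/
def algHeight (α : ℂ) : ℝ :=
  (|((intMinpoly α).leadingCoeff : ℝ)| *
      (((intMinpoly α).map (Int.castRingHom ℂ)).roots.map fun z => max 1 ‖z‖).prod) ^
    (1 / ((intMinpoly α).natDegree : ℝ))

/-- `f` is analytic on the open unit disk, with `|f(z)| ≤ φ(z) ^ (c₀ φ(z))` for
`1/2 ≤ |z| < 1`. -/
def HasDiskGrowth (f : ℂ → ℂ) (c₀ : ℝ) : Prop :=
  AnalyticOnNhd ℂ f (Metric.ball 0 1) ∧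
    ∀ z : ℂ, 1 / 2 ≤ ‖z‖ → ‖z‖ < 1 → ‖f z‖ ≤ diskPhi z ^ (c₀ * diskPhi z)

/-- The rationals `q` in `(0,1)` with `f q` rational and both `q` and `f q` of height at
most `H`. -/
def rationalPoints (f : ℂ → ℂ) (H : ℝ) : Set ℚ :=
  {q | 0 < q ∧ q < 1 ∧ algHeight (q : ℂ) ≤ H ∧
    ∃ r : ℚ, f (q : ℂ) = (r : ℂ) ∧ algHeight (r : ℂ) ≤ H}

/-- The algebraic `α ∈ S` with `f α` algebraic, `[ℚ(α, f α) : ℚ] ≤ d`, and both `α` and `f α`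
of height at most `H`. -/
def algebraicPoints (f : ℂ → ℂ) (S : Set ℂ) (d : ℕ) (H : ℝ) : Set ℂ :=
  {α | α ∈ S ∧ IsAlgebraic ℚ α ∧ IsAlgebraic ℚ (f α) ∧
    Module.finrank ℚ (IntermediateField.adjoin ℚ ({α, f α} : Set ℂ)) ≤ d ∧
    algHeight α ≤ H ∧ algHeight (f α) ≤ H}

end

/-! The argument combines one auxiliary polynomial with a zero estimate.

If `f α` has degree at most d and height at most H, then |f(α)| ≤ H^d. The lower growth of `f` then
forces φ(α) ≤ K, where K is about l·d·log H and 1/l ≤ log b (`norm_le_of_height_le`). So every point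
to be counted lies in the disk |z| ≤ 1 - 1/K.

The pigeonhole principle applied to Taylor coefficients gives a nonzero integer polynomial P in two
variables, with controlled degree T and coefficients, such that P(z, f(z)) is tiny on this disk. By
Liouville's inequality a nonzero value at a counted point could not be that small, so this single P
vanishes at all of them (`exists_bivariateEval_eq_zero`).

It remains to count zeros of F(z) = P(z, f(z)), which needs a point where F is not small. As x tends
to 1, f(x) grows so fast that the term of top degree in y dominates. Its coefficient is a polynomial
in x of degree at most T, so it is nonzero at one of any T + 1 rationals 1 - 1/m, and there it is at
least m^(-T). The upper growth of `f` bounds F on the circle of radius 1 - 1/(2m), and dividing out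
Blaschke factors bounds the number of zeros (`exists_card_zeros_bivariateEval_le`).

The resulting explicit bound is 10^19 N^7 l^2 d^6 K^12, hence of order (log H)^12. The larger
exponents in the theorem follow from it. -/

/-! ### Zeros and smallness: Blaschke products. -/

/-- A function on a neighbourhood of the closed unit disk is bounded by its supremum on the unit
circle times the Blaschke product of any finite set of its zeros. -/
theorem norm_le_mul_prod_blaschke {ρ M : ℝ} (hρ : 1 < ρ) (s : Finset ℂ) :
    ∀ F : ℂ → ℂ, DifferentiableOn ℂ F (Metric.ball 0 ρ) →
      (∀ z : ℂ, ‖z‖ = 1 → ‖F z‖ ≤ M) → (∀ w ∈ s, ‖w‖ < 1 ∧ F w = 0) →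
      ∀ z : ℂ, ‖z‖ ≤ 1 →
        ‖F z‖ ≤ M * ∏ w ∈ s, ‖(z - w) / (1 - (starRingEnd ℂ) w * z)‖ := by
  classical
  induction s using Finset.induction_on with
  | empty =>
    intro F hF hM _ z hz
    have hsub : closure (Metric.ball (0 : ℂ) 1) ⊆ Metric.ball 0 ρ :=
      Metric.closure_ball_subset_closedBall.trans (Metric.closedBall_subset_ball hρ)
    have := Complex.norm_le_of_forall_mem_frontier_norm_le (U := Metric.ball (0 : ℂ) 1)
      Metric.isBounded_ball (DifferentiableOn.diffContOnCl (hF.mono hsub)) (C := M)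
      (fun w hw => hM w (by
        rw [frontier_ball _ one_ne_zero] at hw
        simpa using hw)) (z := z) (by
        rw [closure_ball _ one_ne_zero]
        simpa using hz)
    simpa using this
  | insert w s hws ih =>
    intro F hF hM hz0 z hz
    obtain ⟨hw1, hFw⟩ := hz0 w (Finset.mem_insert_self w s)
    have hwρ : w ∈ Metric.ball (0 : ℂ) ρ := by
      simpa using hw1.trans hρ
    -- Dividing by the Blaschke factor of w instead of u - w preserves the bound M, since |1 - w̄u|
    -- = |u - w| on the unit circle. `dslope` fills the removable singularity at w.
    have hG : DifferentiableOn ℂ (fun u => dslope F w u * (1 - (starRingEnd ℂ) w * u))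
        (Metric.ball 0 ρ) := by
      refine DifferentiableOn.mul
        ((Complex.differentiableOn_dslope (Metric.isOpen_ball.mem_nhds hwρ)).2 hF) ?_
      fun_prop
    have hslope : ∀ u, u ≠ w → dslope F w u = F u / (u - w) := by
      intro u hu
      rw [dslope_of_ne _ hu, slope_def_field, hFw, sub_zero]
    have hden : ∀ u : ℂ, ‖u‖ ≤ 1 → 1 - (starRingEnd ℂ) w * u ≠ 0 := by
      intro u hu h0
      have h1 : (starRingEnd ℂ) w * u = 1 := (sub_eq_zero.1 h0).symm
      have h2 : ‖w‖ * ‖u‖ = 1 := by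
        rw [← RCLike.norm_conj w, ← norm_mul, h1, norm_one]
      nlinarith [norm_nonneg w, norm_nonneg u]
    have hcircle : ∀ u : ℂ, ‖u‖ = 1 → ‖1 - (starRingEnd ℂ) w * u‖ = ‖u - w‖ := by
      intro u hu
      have h1 : u * (starRingEnd ℂ) u = 1 := by
        rw [Complex.mul_conj, Complex.normSq_eq_norm_sq, hu]; simp
      have h2 : 1 - (starRingEnd ℂ) w * u = u * (starRingEnd ℂ) (u - w) := by
        rw [map_sub, mul_sub, h1]; ring
      rw [h2, norm_mul, hu, one_mul, RCLike.norm_conj]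
    have hFG : ∀ u : ℂ, ‖u‖ ≤ 1 → F u = (dslope F w u * (1 - (starRingEnd ℂ) w * u)) *
        ((u - w) / (1 - (starRingEnd ℂ) w * u)) := by
      intro u hu
      by_cases huw : u = w
      · subst huw; simp [hFw]
      · have h1 := hden u hu
        have h2 : u - w ≠ 0 := sub_ne_zero.2 huw
        rw [hslope u huw, mul_assoc, mul_div_cancel₀ _ h1, div_mul_cancel₀ _ h2]
    have key := ih _ hG (fun u hu => by
        have huw : u ≠ w := by rintro rfl; linarith
        have h2 : ‖u - w‖ ≠ 0 := norm_ne_zero_iff.2 (sub_ne_zero.2 huw)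
        rw [norm_mul, hslope u huw, hcircle u hu, norm_div, div_mul_cancel₀ _ h2]
        exact hM u hu)
      (fun v hv => by
        obtain ⟨hv1, hFv⟩ := hz0 v (Finset.mem_insert_of_mem hv)
        refine ⟨hv1, ?_⟩
        have hvw : v ≠ w := by rintro rfl; exact hws hv
        rw [hslope v hvw, hFv]; simp) z hz
    rw [Finset.prod_insert hws, hFG z hz, norm_mul]
    calc _ ≤ (M * ∏ w ∈ s, ‖(z - w) / (1 - (starRingEnd ℂ) w * z)‖) *
          ‖(z - w) / (1 - (starRingEnd ℂ) w * z)‖ := by gcongr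
      _ = _ := by ring

/-- The reason is |1 - w̄z|² - |z - w|² = (1 - |z|²)(1 - |w|²) together with |1 - w̄z| ≤ 2. This
gives a factor 1/4 for the squared quotient, hence 1/8 after the square root. -/
theorem norm_blaschke_le_exp {z w : ℂ} {r : ℝ} (hz : ‖z‖ < 1) (hr : r < 1) (hw : ‖w‖ ≤ r) :
    ‖(z - w) / (1 - (starRingEnd ℂ) w * z)‖ ≤ Real.exp (-((1 - ‖z‖) * (1 - r) / 8)) := by
  have hz0 := norm_nonneg z
  have hw0 := norm_nonneg w
  have hup : ‖1 - (starRingEnd ℂ) w * z‖ ≤ 2 := by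
    refine (norm_sub_le _ _).trans ?_
    rw [norm_one, norm_mul, RCLike.norm_conj]
    nlinarith
  have hlow : 0 < ‖1 - (starRingEnd ℂ) w * z‖ := by
    have h1 := norm_sub_norm_le (1 : ℂ) ((starRingEnd ℂ) w * z)
    rw [norm_one, norm_mul, RCLike.norm_conj] at h1
    nlinarith
  have hid : ‖1 - (starRingEnd ℂ) w * z‖ ^ 2 - ‖z - w‖ ^ 2 = (1 - ‖z‖ ^ 2) * (1 - ‖w‖ ^ 2) := by
    simp only [← Complex.normSq_eq_norm_sq, Complex.normSq_apply, Complex.sub_re, Complex.sub_im,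
      Complex.mul_re, Complex.mul_im, Complex.conj_re, Complex.conj_im, Complex.one_re,
      Complex.one_im]
    ring
  have h3 : (1 - ‖z‖) * (1 - r) ≤ (1 - ‖z‖ ^ 2) * (1 - ‖w‖ ^ 2) := by
    apply mul_le_mul <;> nlinarith
  have hpos : 0 ≤ (1 - ‖z‖) * (1 - r) := by
    apply mul_nonneg <;> linarith
  rw [norm_div]
  refine le_of_sq_le_sq ?_ (Real.exp_pos _).le
  rw [← Real.exp_nat_mul, div_pow]
  have h4 : ‖z - w‖ ^ 2 / ‖1 - (starRingEnd ℂ) w * z‖ ^ 2 ≤ 1 - (1 - ‖z‖) * (1 - r) / 4 := by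
    rw [div_le_iff₀ (by positivity)]
    have h5 : ‖1 - (starRingEnd ℂ) w * z‖ ^ 2 ≤ 4 := by nlinarith
    nlinarith
  refine h4.trans ?_
  have := Real.add_one_le_exp (-((1 - ‖z‖) * (1 - r) / 4))
  refine le_trans (by linarith) (this.trans (le_of_eq ?_))
  congr 1
  push_cast
  ring

/-- If a function analytic on the unit disk is bounded by `M` on the circle of radius `R`, and has
at least `#s` zeros in the disk of radius `r < R`, then it is small inside the disk of
radius `R`. -/
theorem norm_le_mul_exp_neg_card_zeros {F : ℂ → ℂ} (hF : DifferentiableOn ℂ F (Metric.ball 0 1))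
    {M R r : ℝ} (hR0 : 0 < R) (hR1 : R < 1) (hrR : r < R) (hM : ∀ z : ℂ, ‖z‖ = R → ‖F z‖ ≤ M)
    (s : Finset ℂ) (hs : ∀ w ∈ s, ‖w‖ ≤ r ∧ F w = 0) {x : ℂ} (hx : ‖x‖ < R) :
    ‖F x‖ ≤ M * Real.exp (-(s.card * ((R - ‖x‖) * (R - r) / 8))) := by
  classical
  have hM0 : 0 ≤ M := (norm_nonneg _).trans (hM R (by simp [abs_of_pos hR0]))
  have hRc : (R : ℂ) ≠ 0 := by exact_mod_cast hR0.ne'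
  have hRn : ‖(R : ℂ)‖ = R := by simp [abs_of_pos hR0]
  have hG : DifferentiableOn ℂ (fun u : ℂ => F (R * u)) (Metric.ball 0 R⁻¹) := by
    refine hF.comp (by fun_prop) ?_
    intro u hu
    simp only [mem_ball_zero_iff, norm_mul, hRn] at hu ⊢
    calc R * ‖u‖ < R * R⁻¹ := by gcongr
      _ = 1 := mul_inv_cancel₀ hR0.ne'
  have hinj : Function.Injective (fun w : ℂ => w / R) := fun u v h => by
    simpa [div_left_inj' hRc] using h
  have key := norm_le_mul_prod_blaschke (M := M) ((one_lt_inv₀ hR0).2 hR1)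
    (s.map ⟨fun w : ℂ => w / R, hinj⟩) _ hG
    (fun u hu => hM _ (by rw [norm_mul, hRn, hu, mul_one]))
    (fun v hv => by
      simp only [Finset.mem_map, Function.Embedding.coeFn_mk] at hv
      obtain ⟨w, hw, rfl⟩ := hv
      refine ⟨?_, ?_⟩
      · rw [norm_div, hRn, div_lt_one hR0]
        exact (hs w hw).1.trans_lt hrR
      · rw [mul_div_cancel₀ _ hRc]; exact (hs w hw).2)
    (x / R) (by rw [norm_div, hRn, div_le_one hR0]; exact hx.le)
  rw [mul_div_cancel₀ _ hRc, Finset.prod_map] at key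
  refine key.trans (mul_le_mul_of_nonneg_left ?_ hM0)
  -- Rescaling the disk of radius R < 1 to the unit disk only increases distances to the boundary.
  have hle : ∀ t : ℝ, t ≤ R → R - t ≤ 1 - t / R := by
    intro t ht
    have : 1 - t / R = (R - t) / R := by field_simp
    rw [this, le_div_iff₀ hR0]
    nlinarith
  refine (Finset.prod_le_prod (fun _ _ => norm_nonneg _) (fun w hw =>
    norm_blaschke_le_exp (r := r / R) (by rw [norm_div, hRn, div_lt_one hR0]; exact hx)
      (by rw [div_lt_one hR0]; exact hrR) (by
        simp only [Function.Embedding.coeFn_mk]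
        rw [norm_div, hRn]
        exact div_le_div_of_nonneg_right (hs w hw).1 hR0.le))).trans ?_
  rw [Finset.prod_const, ← Real.exp_nat_mul, norm_div, hRn]
  apply Real.exp_le_exp.2
  have h1 : (R - ‖x‖) * (R - r) ≤ (1 - ‖x‖ / R) * (1 - r / R) :=
    mul_le_mul (hle _ hx.le) (hle _ hrR.le) (by linarith)
      (le_trans (by linarith) (hle _ hx.le))
  have h2 : (0 : ℝ) ≤ s.card := Nat.cast_nonneg _
  nlinarith

/-! ### Pigeonhole principle and small integer combinations of functions. -/

/-- Real linear forms in many integer variables take simultaneously small values. -/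
theorem exists_int_vec_small_real_forms {ι κ : Type*} [Fintype ι] [Fintype κ] (c : κ → ι → ℝ)
    {M : ℝ} (hM : 0 < M) (hc : ∀ k i, |c k i| ≤ M) {B s : ℕ} (hB : 3 ≤ B) (hι : 0 < Fintype.card ι)
    (hcard : Fintype.card κ * (s + 1) ≤ Fintype.card ι) :
    ∃ p : ι → ℤ, p ≠ 0 ∧ (∀ i, |p i| ≤ B) ∧
      ∀ k, |∑ i, p i * c k i| ≤ Fintype.card ι * B * M / (B : ℝ) ^ s := by
  classical
  set Y : ℝ := Fintype.card ι * B * M with hY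
  have hBpos : (0 : ℝ) < B := by exact_mod_cast (by omega : 0 < B)
  have hιpos : (0 : ℝ) < Fintype.card ι := by exact_mod_cast hι
  have hYpos : 0 < Y := by positivity
  set Q : ℕ := B ^ s with hQ
  have hQpos : 0 < Q := by positivity
  have hQr : (0 : ℝ) < Q := by exact_mod_cast hQpos
  let form : (ι → ℤ) → κ → ℝ := fun p k => ∑ i, p i * c k i
  let g : (ι → ℤ) → κ → ℤ := fun p k => ⌊form p k * (Q / Y)⌋
  let S : Finset (ι → ℤ) := Fintype.piFinset fun _ => Finset.Icc (0 : ℤ) B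
  let W : Finset (κ → ℤ) := Fintype.piFinset fun _ => Finset.Icc (-(Q : ℤ)) Q
  have hmaps : Set.MapsTo g S W := by
    intro p hp
    have hp' : ∀ i, 0 ≤ p i ∧ p i ≤ B := fun i =>
      Finset.mem_Icc.1 (Fintype.mem_piFinset.1 hp i)
    have hb : ∀ k, |form p k| ≤ Y := by
      intro k
      calc |form p k| ≤ ∑ i, |p i * c k i| := Finset.abs_sum_le_sum_abs _ _
        _ ≤ ∑ _i : ι, (B : ℝ) * M := by
          refine Finset.sum_le_sum fun i _ => ?_
          rw [abs_mul]
          have h1 : |(p i : ℝ)| ≤ B := by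
            rw [abs_of_nonneg (by exact_mod_cast (hp' i).1)]
            exact_mod_cast (hp' i).2
          exact mul_le_mul h1 (hc k i) (abs_nonneg _) hBpos.le
        _ = Y := by simp [hY, mul_assoc]
    simp only [W, Finset.mem_coe, Fintype.mem_piFinset, Finset.mem_Icc]
    intro k
    obtain ⟨h1, h2⟩ := abs_le.1 (hb k)
    have hsc : Y * (Q / Y) = Q := by field_simp
    have hpos : 0 < Q / Y := by positivity
    constructor
    · apply Int.le_floor.2
      push_cast
      nlinarith
    · apply Int.floor_le_iff.2
      push_cast
      nlinarith
  have hlt : W.card < S.card := by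
    have hS : S.card = (B + 1) ^ Fintype.card ι := by
      simp only [S, Fintype.card_piFinset, Int.card_Icc, Finset.prod_const, Finset.card_univ]
      congr 1
    have hW : W.card = (2 * Q + 1) ^ Fintype.card κ := by
      simp only [W, Fintype.card_piFinset, Int.card_Icc, Finset.prod_const, Finset.card_univ]
      congr 1
      omega
    rw [hS, hW]
    -- Each form falls into one of 2Q + 1 cells of width Y/Q, and B ≥ 3 gives 2Q + 1 ≤ BQ = B^(s+1).
    calc (2 * Q + 1) ^ Fintype.card κ ≤ (B ^ (s + 1)) ^ Fintype.card κ := by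
          apply Nat.pow_le_pow_left
          rw [pow_succ, ← hQ]
          nlinarith
      _ = B ^ (Fintype.card κ * (s + 1)) := by rw [← pow_mul, mul_comm]
      _ ≤ B ^ Fintype.card ι := Nat.pow_le_pow_right (by omega) hcard
      _ < (B + 1) ^ Fintype.card ι := Nat.pow_lt_pow_left (by omega) hι.ne'
  obtain ⟨p, hp, q, hq, hpq, hg⟩ := Finset.exists_ne_map_eq_of_card_lt_of_maps_to hlt hmaps
  have hp' : ∀ i, 0 ≤ p i ∧ p i ≤ B := fun i =>
      Finset.mem_Icc.1 (Fintype.mem_piFinset.1 hp i)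
  have hq' : ∀ i, 0 ≤ q i ∧ q i ≤ B := fun i =>
      Finset.mem_Icc.1 (Fintype.mem_piFinset.1 hq i)
  refine ⟨p - q, sub_ne_zero.2 hpq, fun i => ?_, fun k => ?_⟩
  · have := hp' i
    have := hq' i
    rw [Pi.sub_apply, abs_le]
    omega
  · have h1 : |form p k * (Q / Y) - form q k * (Q / Y)| < 1 :=
      Int.abs_sub_lt_one_of_floor_eq_floor (congrFun hg k)
    have h2 : ∑ i, ((p - q) i : ℝ) * c k i = form p k - form q k := by
      simp only [form, ← Finset.sum_sub_distrib, Pi.sub_apply]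
      refine Finset.sum_congr rfl fun i _ => ?_
      push_cast
      ring
    have h3 : ((B : ℝ) ^ s) = Q := by simp [hQ]
    rw [h2, h3, le_div_iff₀ hQr]
    rw [← sub_mul, abs_mul, abs_of_pos (by positivity : 0 < (Q : ℝ) / Y), ← mul_div_assoc,
      div_lt_one hYpos] at h1
    exact h1.le

/-- Complex linear forms in many integer variables take simultaneously small values. -/
theorem exists_int_vec_small_complex_forms {ι : Type*} [Fintype ι] {n : ℕ} (c : Fin n → ι → ℂ)
    {M : ℝ} (hM : 0 < M) (hc : ∀ k i, ‖c k i‖ ≤ M) {B s : ℕ} (hB : 3 ≤ B) (hι : 0 < Fintype.card ι)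
    (hcard : 2 * n * (s + 1) ≤ Fintype.card ι) :
    ∃ p : ι → ℤ, p ≠ 0 ∧ (∀ i, |p i| ≤ B) ∧
      ∀ k, ‖∑ i, (p i : ℂ) * c k i‖ ≤ 2 * (Fintype.card ι * B * M / (B : ℝ) ^ s) := by
  obtain ⟨p, hp0, hpB, hp⟩ := exists_int_vec_small_real_forms
    (κ := Fin n ⊕ Fin n) (Sum.elim (fun k i => (c k i).re) (fun k i => (c k i).im)) hM
    (by
      rintro (k | k) i
      · exact (Complex.abs_re_le_norm _).trans (hc k i)
      · exact (Complex.abs_im_le_norm _).trans (hc k i)) hB hι (s := s)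
    (by simpa [two_mul] using hcard)
  refine ⟨p, hp0, hpB, fun k => ?_⟩
  have hre := hp (Sum.inl k)
  have him := hp (Sum.inr k)
  refine (Complex.norm_le_abs_re_add_abs_im _).trans ?_
  have e1 : (∑ i, (p i : ℂ) * c k i).re = ∑ i, (p i : ℝ) * (c k i).re := by simp
  have e2 : (∑ i, (p i : ℂ) * c k i).im = ∑ i, (p i : ℝ) * (c k i).im := by simp
  rw [e1, e2, two_mul]
  exact add_le_add hre him

theorem hasSum_geometric_tail {θ : ℝ} (h0 : 0 ≤ θ) (h1 : θ < 1) (n : ℕ) :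
    HasSum (fun k => if n ≤ k then θ ^ k else 0) (θ ^ n / (1 - θ)) := by
  let f : ℕ → ℝ := fun k => if n ≤ k then θ ^ k else 0
  have h2 : HasSum (fun k => f (k + n)) (θ ^ n / (1 - θ)) := by
    refine Eq.subst (motive := fun F => HasSum F _) (funext fun k => ?_)
      ((hasSum_geometric_of_lt_one h0 h1).mul_left (θ ^ n))
    simp [f, pow_add, mul_comm]
  have h3 : ∑ k ∈ Finset.range n, f k = 0 :=
    Finset.sum_eq_zero fun k hk => if_neg (Nat.not_le.2 (Finset.mem_range.1 hk))
  have h4 := (hasSum_nat_add_iff n).1 h2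
  rw [h3, add_zero] at h4
  exact h4

/-- Among finitely many functions analytic on the unit disk and bounded on a circle there is an
integer linear combination that is small on a smaller disk. -/
theorem exists_int_combination_small {ι : Type*} [Fintype ι] {g : ι → ℂ → ℂ}
    (hg : ∀ i, DifferentiableOn ℂ (g i) (Metric.ball 0 1)) {M R r : ℝ} (hM : 0 < M) (hR0 : 0 < R)
    (hR1 : R < 1) (hr : 0 ≤ r) (hrR : r < R) (hgM : ∀ i z, ‖z‖ = R → ‖g i z‖ ≤ M) {B s n : ℕ}
    (hB : 3 ≤ B) (hι : 0 < Fintype.card ι) (hcard : 2 * n * (s + 1) ≤ Fintype.card ι) :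
    ∃ p : ι → ℤ, p ≠ 0 ∧ (∀ i, |p i| ≤ B) ∧ ∀ z : ℂ, ‖z‖ ≤ r →
      ‖∑ i, (p i : ℂ) * g i z‖ ≤
        Fintype.card ι * B * M * (2 / (B : ℝ) ^ s + (r / R) ^ n) / (1 - r / R) := by
  have hRc : (R : ℂ) ≠ 0 := by exact_mod_cast hR0.ne'
  -- Taylor coefficients scaled by R^k, so that Cauchy's estimate bounds all of them by the same M.
  let c : ℕ → ι → ℂ := fun k i => ((k.factorial : ℂ))⁻¹ * iteratedDeriv k (g i) 0 * (R : ℂ) ^ k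
  have hsub : closure (Metric.ball (0 : ℂ) R) ⊆ Metric.ball 0 1 :=
    Metric.closure_ball_subset_closedBall.trans (Metric.closedBall_subset_ball hR1)
  have hc : ∀ k i, ‖c k i‖ ≤ M := by
    intro k i
    have h1 := Complex.norm_iteratedDeriv_le_of_forall_mem_sphere_norm_le k hR0
      (DifferentiableOn.diffContOnCl ((hg i).mono hsub)) (C := M)
      (fun z hz => hgM i z (by simpa using hz))
    have hk : (0 : ℝ) < k.factorial := by exact_mod_cast k.factorial_pos
    simp only [c, norm_mul, norm_inv, norm_pow, Complex.norm_natCast, Complex.norm_real,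
      Real.norm_eq_abs, abs_of_pos hR0]
    calc _ ≤ (k.factorial : ℝ)⁻¹ * (k.factorial * M / R ^ k) * R ^ k := by gcongr
      _ = M := by field_simp
  obtain ⟨p, hp0, hpB, hp⟩ := exists_int_vec_small_complex_forms (fun (k : Fin n) i => c k i) hM
    (fun k i => hc k i) hB hι hcard
  refine ⟨p, hp0, hpB, fun z hz => ?_⟩
  set θ : ℝ := r / R with hθ
  have hθ0 : 0 ≤ θ := by positivity
  have hθ1 : θ < 1 := (div_lt_one hR0).2 hrR
  set Y : ℝ := Fintype.card ι * B * M with hY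
  have hY0 : 0 ≤ Y := by positivity
  have hsum : HasSum (fun k => (∑ i, (p i : ℂ) * c k i) * (z / R) ^ k)
      (∑ i, (p i : ℂ) * g i z) := by
    have h1 : ∀ i, HasSum (fun k => (p i : ℂ) * (c k i * (z / R) ^ k)) ((p i : ℂ) * g i z) := by
      intro i
      have h2 := Complex.hasSum_taylorSeries_on_ball (hg i) (z := z)
        (by simpa using hz.trans_lt (hrR.trans hR1))
      refine HasSum.mul_left _ ?_
      refine Eq.subst (motive := fun F => HasSum F _) (funext fun k => ?_)
        h2
      simp only [c, smul_eq_mul, sub_zero, div_pow]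
      field_simp
    have h3 := hasSum_sum (s := Finset.univ) fun i _ => h1 i
    refine Eq.subst (motive := fun F => HasSum F _) (funext fun k => ?_)
        h3
    rw [Finset.sum_mul]
    exact Finset.sum_congr rfl fun i _ => by ring
  have hgeo := hasSum_geometric_of_lt_one hθ0 hθ1
  have htail := (hasSum_geometric_tail hθ0 hθ1 n).mul_left Y
  have htot := (hgeo.mul_left (2 * (Y / (B : ℝ) ^ s))).add htail
  have hw : ‖z / R‖ ≤ θ := by
    rw [norm_div, Complex.norm_real, Real.norm_eq_abs, abs_of_pos hR0, hθ]
    gcongr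
  refine (hsum.norm_le_of_bounded htot fun k => ?_).trans (le_of_eq (by ring))
  rw [norm_mul, norm_pow]
  have hpow : ‖z / R‖ ^ k ≤ θ ^ k := by gcongr
  -- The first n coefficients are small by pigeonhole. The others have only the trivial bound Y, and
  -- (r/R)^k makes their sum small.
  by_cases hk : n ≤ k
  · have h1 : ‖∑ i, (p i : ℂ) * c k i‖ ≤ Y := by
      calc _ ≤ ∑ i, ‖(p i : ℂ) * c k i‖ := norm_sum_le _ _
        _ ≤ ∑ _i : ι, (B : ℝ) * M := by
          refine Finset.sum_le_sum fun i _ => ?_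
          rw [norm_mul, Complex.norm_intCast]
          have h1 : |(p i : ℝ)| ≤ B := by exact_mod_cast hpB i
          exact mul_le_mul h1 (hc k i) (norm_nonneg _) (Nat.cast_nonneg _)
        _ = Y := by simp [hY, mul_assoc]
    rw [if_pos hk]
    have h2 : ‖∑ i, (p i : ℂ) * c k i‖ * ‖z / R‖ ^ k ≤ Y * θ ^ k := by gcongr
    have h3 : 0 ≤ 2 * (Y / (B : ℝ) ^ s) * θ ^ k := by positivity
    linarith
  · rw [if_neg hk, mul_zero, add_zero]
    have h1 := hp ⟨k, Nat.not_le.1 hk⟩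
    gcongr

/-! ### Size of integer polynomials in two variables. -/

/-- The value at `(x, y)` of the polynomial of degree at most `T` in each variable with integer
coefficients `p`. -/
noncomputable def bivariateEval {T : ℕ} (p : Fin (T + 1) × Fin (T + 1) → ℤ) (x y : ℂ) : ℂ :=
  ∑ i, (p i : ℂ) * (x ^ (i.1 : ℕ) * y ^ (i.2 : ℕ))

theorem norm_bivariateEval_le {T : ℕ} {p : Fin (T + 1) × Fin (T + 1) → ℤ} {B : ℕ}
    (hp : ∀ i, |p i| ≤ B) {x y : ℂ} {M : ℝ} (hM : 1 ≤ M) (hx : ‖x‖ ≤ 1) (hy : ‖y‖ ≤ M) :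
    ‖bivariateEval p x y‖ ≤ ((T : ℝ) + 1) ^ 2 * B * M ^ T := by
  calc _ ≤ ∑ i : Fin (T + 1) × Fin (T + 1), ‖(p i : ℂ) * (x ^ (i.1 : ℕ) * y ^ (i.2 : ℕ))‖ :=
        norm_sum_le _ _
    _ ≤ ∑ _i : Fin (T + 1) × Fin (T + 1), (B : ℝ) * (1 * M ^ T) := by
        refine Finset.sum_le_sum fun i _ => ?_
        rw [norm_mul, norm_mul, norm_pow, norm_pow, Complex.norm_intCast]
        have h1 : |(p i : ℝ)| ≤ B := by exact_mod_cast hp i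
        have h2 : ‖y‖ ^ (i.2 : ℕ) ≤ M ^ T :=
          (pow_le_pow_left₀ (norm_nonneg _) hy _).trans
            (pow_le_pow_right₀ hM (Nat.lt_succ_iff.1 i.2.2))
        have h3 : ‖x‖ ^ (i.1 : ℕ) ≤ 1 := pow_le_one₀ (norm_nonneg _) hx
        gcongr
    _ = _ := by simp; ring

/-- A nonzero integer polynomial in two variables is not too small at `(1 - 1 / m, y)` for some
`m` in any sufficiently long interval of integers, as soon as `y` is large. -/
theorem exists_bivariateEval_lower_bound {T : ℕ} {p : Fin (T + 1) × Fin (T + 1) → ℤ} {B : ℕ}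
    (hp0 : p ≠ 0) (hp : ∀ i, |p i| ≤ B) {m₀ : ℕ} (hm₀ : 1 ≤ m₀) :
    ∃ m : ℕ, m₀ ≤ m ∧ m ≤ m₀ + T ∧ ∀ y : ℂ, 2 * ((T : ℝ) + 1) ^ 2 * B * (m : ℝ) ^ T ≤ ‖y‖ →
      1 ≤ ‖y‖ → 1 ≤ ‖bivariateEval p (1 - 1 / (m : ℂ)) y‖ * (2 * (m : ℝ) ^ T) := by
  classical
  obtain ⟨i₀, hi₀⟩ := Function.ne_iff.1 hp0
  obtain ⟨⟨i₁, k⟩, hk, hmax⟩ := Finset.exists_max_image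
    (Finset.univ.filter fun i => p i ≠ 0) (fun i => i.2) ⟨i₀, by simpa using hi₀⟩
  simp only [Finset.mem_filter, Finset.mem_univ, true_and] at hk hmax
  -- Here k is the degree of the polynomial in y, and q is the coefficient of y^k.
  let q : ℂ[X] := ∑ i : Fin (T + 1), Polynomial.C (p (i, k) : ℂ) * Polynomial.X ^ (i : ℕ)
  have hqcoeff : q.coeff i₁ = p (i₁, k) := by
    simp only [q, Polynomial.finsetSum_coeff, Polynomial.coeff_C_mul, Polynomial.coeff_X_pow]
    rw [Finset.sum_eq_single i₁]
    · simp
    · intro b _ hb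
      simp [Fin.val_inj, Ne.symm hb]
    · simp
  have hq0 : q ≠ 0 := by
    intro h
    rw [h, Polynomial.coeff_zero] at hqcoeff
    exact hk (by exact_mod_cast hqcoeff.symm)
  have hqdeg : q.natDegree < T + 1 := by
    refine Nat.lt_succ_iff.2 (Polynomial.natDegree_sum_le_of_forall_le _ _ fun i _ => ?_)
    exact (Polynomial.natDegree_C_mul_X_pow_le _ _).trans (Nat.lt_succ_iff.1 i.2)
  have hex : ∃ t : Fin (T + 1), q.eval (1 - 1 / ((m₀ + (t : ℕ) : ℕ) : ℂ)) ≠ 0 := by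
    by_contra! hcon
    refine hq0 (Polynomial.eq_zero_of_natDegree_lt_card_of_eval_eq_zero q
      (f := fun t : Fin (T + 1) => 1 - 1 / ((m₀ + (t : ℕ) : ℕ) : ℂ)) ?_ hcon (by simpa using hqdeg))
    intro a b hab
    simp only [sub_right_inj, one_div, inv_inj, Nat.cast_inj] at hab
    exact Fin.ext (by omega)
  obtain ⟨t, ht⟩ := hex
  refine ⟨m₀ + t, by omega, by omega, fun y hy hy1 => ?_⟩
  set m : ℕ := m₀ + t with hm
  have hmpos : 0 < m := by omega
  have hmr : (0 : ℝ) < m := by exact_mod_cast hmpos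
  have hmc : (m : ℂ) ≠ 0 := by exact_mod_cast hmpos.ne'
  set x : ℂ := 1 - 1 / (m : ℂ) with hx
  have hqx : q.eval x = ∑ i : Fin (T + 1), (p (i, k) : ℂ) * x ^ (i : ℕ) := by
    simp [q, Polynomial.eval_finsetSum]
  have hxn : ‖x‖ ≤ 1 := by
    have h1 : x = ((1 - 1 / (m : ℝ) : ℝ) : ℂ) := by rw [hx]; push_cast; rfl
    have h2 : 1 / (m : ℝ) ≤ 1 := by
      rw [div_le_one hmr]; exact_mod_cast hmpos
    have h3 : 0 < 1 / (m : ℝ) := by positivity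
    rw [h1, Complex.norm_real, Real.norm_eq_abs, abs_le]
    constructor <;> linarith
  have hlow : 1 ≤ ‖q.eval x‖ * (m : ℝ) ^ T := by
    -- Clearing the denominator m^T of q(1 - 1/m) leaves a nonzero integer.
    let Z : ℤ := ∑ i : Fin (T + 1), p (i, k) * ((m : ℤ) - 1) ^ (i : ℕ) * (m : ℤ) ^ (T - (i : ℕ))
    have hZ : (Z : ℂ) = q.eval x * (m : ℂ) ^ T := by
      rw [hqx, Finset.sum_mul]
      push_cast [Z]
      refine Finset.sum_congr rfl fun i _ => ?_
      have hi : (m : ℂ) ^ T = (m : ℂ) ^ (i : ℕ) * (m : ℂ) ^ (T - (i : ℕ)) := by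
        rw [← pow_add, Nat.add_sub_cancel' (Nat.lt_succ_iff.1 i.2)]
      have hxm : (m : ℂ) - 1 = x * m := by rw [hx]; field_simp
      rw [hi, hxm, mul_pow]
      ring
    have hZ0 : Z ≠ 0 := by
      intro h
      rw [h, Int.cast_zero] at hZ
      exact mul_ne_zero ht (pow_ne_zero _ hmc) hZ.symm
    have h1 : ‖(Z : ℂ)‖ = ‖q.eval x‖ * (m : ℝ) ^ T := by
      rw [hZ, norm_mul, norm_pow, Complex.norm_natCast]
    rw [← h1, Complex.norm_intCast]
    exact_mod_cast Int.one_le_abs hZ0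
  have hsplit : bivariateEval p x y = q.eval x * y ^ (k : ℕ) +
      ∑ i ∈ Finset.univ.filter (fun i : Fin (T + 1) × Fin (T + 1) => ¬ i.2 = k),
        (p i : ℂ) * (x ^ (i.1 : ℕ) * y ^ (i.2 : ℕ)) := by
    rw [bivariateEval, ← Finset.sum_filter_add_sum_filter_not _ (fun i => i.2 = k), hqx,
      Finset.sum_mul]
    congr 1
    refine (Finset.sum_bij (fun i _ => (i, k)) ?_ ?_ ?_ ?_).symm
    · simp
    · intro a _ b _ h
      exact (Prod.mk.inj h).1
    · rintro ⟨a, b⟩ h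
      simp only [Finset.mem_filter, Finset.mem_univ, true_and] at h
      exact ⟨a, Finset.mem_univ _, by rw [h]⟩
    · intro a _
      ring
  -- Only powers of y below k remain. Multiplying by |y| avoids the exponent k - 1, as k may be 0.
  -- With the lower bound on |y|, the remainder is at most half the guaranteed size |y|^k / m^T of
  -- the leading term.
  have hrest : ‖∑ i ∈ Finset.univ.filter (fun i : Fin (T + 1) × Fin (T + 1) => ¬ i.2 = k),
        (p i : ℂ) * (x ^ (i.1 : ℕ) * y ^ (i.2 : ℕ))‖ * ‖y‖ ≤
        ((T : ℝ) + 1) ^ 2 * B * ‖y‖ ^ (k : ℕ) := by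
    calc _ ≤ (∑ i ∈ Finset.univ.filter (fun i : Fin (T + 1) × Fin (T + 1) => ¬ i.2 = k),
          ‖(p i : ℂ) * (x ^ (i.1 : ℕ) * y ^ (i.2 : ℕ))‖) * ‖y‖ := by
          gcongr; exact norm_sum_le _ _
      _ ≤ ∑ _i ∈ Finset.univ.filter (fun i : Fin (T + 1) × Fin (T + 1) => ¬ i.2 = k),
          (B : ℝ) * ‖y‖ ^ (k : ℕ) := by
          rw [Finset.sum_mul]
          refine Finset.sum_le_sum fun i hi => ?_
          simp only [Finset.mem_filter, Finset.mem_univ, true_and] at hi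
          by_cases hpi : p i = 0
          · rw [hpi]; simp only [Int.cast_zero, zero_mul, norm_zero]; positivity
          · have hlt : i.2 < k := lt_of_le_of_ne (hmax i hpi) hi
            have h1 : |(p i : ℝ)| ≤ B := by exact_mod_cast hp i
            have h3 : ‖x‖ ^ (i.1 : ℕ) ≤ 1 := pow_le_one₀ (norm_nonneg _) hxn
            have h4 : ‖y‖ ^ (i.2 : ℕ) * ‖y‖ ≤ ‖y‖ ^ (k : ℕ) := by
              rw [← pow_succ]
              exact pow_le_pow_right₀ hy1 hlt
            rw [norm_mul, norm_mul, norm_pow, norm_pow, Complex.norm_intCast]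
            calc |(p i : ℝ)| * (‖x‖ ^ (i.1 : ℕ) * ‖y‖ ^ (i.2 : ℕ)) * ‖y‖
                = |(p i : ℝ)| * (‖x‖ ^ (i.1 : ℕ) * (‖y‖ ^ (i.2 : ℕ) * ‖y‖)) := by ring
              _ ≤ B * (1 * ‖y‖ ^ (k : ℕ)) := by gcongr
              _ = _ := by ring
      _ ≤ ∑ _i : Fin (T + 1) × Fin (T + 1), (B : ℝ) * ‖y‖ ^ (k : ℕ) :=
          Finset.sum_le_sum_of_subset_of_nonneg (Finset.filter_subset _ _)
            fun _ _ _ => by positivity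
      _ = _ := by simp; ring
  set rest := ∑ i ∈ Finset.univ.filter (fun i : Fin (T + 1) × Fin (T + 1) => ¬ i.2 = k),
        (p i : ℂ) * (x ^ (i.1 : ℕ) * y ^ (i.2 : ℕ)) with hrestdef
  have hF : ‖q.eval x‖ * ‖y‖ ^ (k : ℕ) - ‖rest‖ ≤ ‖bivariateEval p x y‖ := by
    have h1 := norm_sub_le_norm_add (q.eval x * y ^ (k : ℕ)) rest
    rw [norm_mul, norm_pow] at h1
    rw [hsplit]
    exact h1
  set Y := ‖y‖ with hYdef
  set P := (m : ℝ) ^ T with hP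
  have hPpos : 0 < P := by positivity
  have hYpos : 0 < Y := by linarith
  have hYk : 1 ≤ Y ^ (k : ℕ) := one_le_pow₀ hy1
  have h5 : Y ^ (k : ℕ) * Y ≤ 2 * P * ‖bivariateEval p x y‖ * Y := by
    have h6 : 2 * P * ((‖q.eval x‖ * Y ^ (k : ℕ) - ‖rest‖) * Y) ≤
        2 * P * (‖bivariateEval p x y‖ * Y) := by gcongr
    have h7 : 2 * P * (‖rest‖ * Y) ≤ 2 * P * (((T : ℝ) + 1) ^ 2 * B * Y ^ (k : ℕ)) := by gcongr
    have h8 : 2 * ((T : ℝ) + 1) ^ 2 * B * P * Y ^ (k : ℕ) ≤ Y * Y ^ (k : ℕ) := by gcongr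
    have h9 : 1 * (Y ^ (k : ℕ) * Y) ≤ ‖q.eval x‖ * P * (Y ^ (k : ℕ) * Y) := by gcongr
    nlinarith
  have h10 : Y ^ (k : ℕ) ≤ 2 * P * ‖bivariateEval p x y‖ := le_of_mul_le_mul_right h5 hYpos
  linarith

/-! ### Heights and Liouville's inequality. -/

theorem exists_C_mul_intMinpoly_map (α : ℂ) (hα : IsAlgebraic ℚ α) :
    ∃ u v : ℚ, u ≠ 0 ∧ v ≠ 0 ∧
      Polynomial.C u * (intMinpoly α).map (algebraMap ℤ ℚ) = Polynomial.C v * minpoly ℚ α := by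
  obtain ⟨b, hb, hbe⟩ := IsLocalization.integerNormalization_spec (nonZeroDivisors ℤ) (minpoly ℚ α)
  set g := IsLocalization.integerNormalization (nonZeroDivisors ℤ) (minpoly ℚ α) with hg
  have hb0 : b ≠ 0 := nonZeroDivisors.ne_zero hb
  have hg0 : g ≠ 0 := by
    rw [hg, Ne, IsFractionRing.integerNormalization_eq_zero_iff]
    exact minpoly.ne_zero hα.isIntegral
  refine ⟨(g.content : ℚ), (b : ℚ), ?_, by exact_mod_cast hb0, ?_⟩
  · exact_mod_cast mt Polynomial.content_eq_zero_iff.1 hg0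
  · have h1 : intMinpoly α = g.primPart := rfl
    have h2 : (Polynomial.C g.content * g.primPart).map (algebraMap ℤ ℚ) = b • minpoly ℚ α := by
      rw [← Polynomial.eq_C_content_mul_primPart, hbe]
    rw [h1]
    rw [Polynomial.map_mul, Polynomial.map_C] at h2
    simp only [eq_intCast] at h2
    rw [h2]
    simp

theorem intMinpoly_ne_zero (α : ℂ) : intMinpoly α ≠ 0 := Polynomial.primPart_ne_zero _

theorem natDegree_intMinpoly {α : ℂ} (hα : IsAlgebraic ℚ α) :
    (intMinpoly α).natDegree = (minpoly ℚ α).natDegree := by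
  obtain ⟨u, v, hu, hv, h⟩ := exists_C_mul_intMinpoly_map α hα
  have h1 := congrArg Polynomial.natDegree h
  rwa [Polynomial.natDegree_C_mul hu, Polynomial.natDegree_C_mul hv,
    Polynomial.natDegree_map_eq_of_injective (algebraMap ℤ ℚ).injective_int] at h1

theorem aeval_intMinpoly_eq_zero {A : Type*} [Field A] [Algebra ℚ A] {α : ℂ}
    (hα : IsAlgebraic ℚ α) {x : A} (hx : aeval x (minpoly ℚ α) = 0) :
    aeval x (intMinpoly α) = 0 := by
  obtain ⟨u, v, hu, hv, h⟩ := exists_C_mul_intMinpoly_map α hα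
  have h1 := congrArg (aeval x) h
  rw [map_mul, map_mul, hx, mul_zero, aeval_C, Polynomial.aeval_map_algebraMap] at h1
  exact (mul_eq_zero.1 h1).resolve_left ((map_ne_zero (algebraMap ℚ A)).2 hu)

/-- The leading coefficient of the integral minimal polynomial of `α` times any conjugate of `α` is
bounded by a power of the height. -/
theorem leadingCoeff_mul_max_le_height_pow {α : ℂ} (hα : IsAlgebraic ℚ α) {d : ℕ} {H : ℝ}
    (hd : (minpoly ℚ α).natDegree ≤ d) (hH1 : 1 ≤ H) (hH : algHeight α ≤ H) {z : ℂ}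
    (hz : aeval z (minpoly ℚ α) = 0) :
    |((intMinpoly α).leadingCoeff : ℝ)| * max 1 ‖z‖ ≤ H ^ d := by
  set P := intMinpoly α with hP
  have hP0 : P ≠ 0 := intMinpoly_ne_zero α
  have hdeg : 0 < P.natDegree := by
    rw [hP, natDegree_intMinpoly hα]
    exact minpoly.natDegree_pos hα.isIntegral
  have hmap0 : P.map (Int.castRingHom ℂ) ≠ 0 :=
    (Polynomial.map_ne_zero_iff (Int.castRingHom ℂ).injective_int).2 hP0
  have hroot : z ∈ (P.map (Int.castRingHom ℂ)).roots := by
    rw [Polynomial.mem_roots hmap0, Polynomial.IsRoot, Polynomial.eval_map]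
    exact aeval_intMinpoly_eq_zero hα hz
  set m := (P.map (Int.castRingHom ℂ)).roots.map fun z => max 1 ‖z‖ with hm
  have hm1 : ∀ t ∈ m, (1 : ℝ) ≤ t := by
    intro t ht
    obtain ⟨w, _, rfl⟩ := Multiset.mem_map.1 ht
    exact le_max_left _ _
  have hle : max 1 ‖z‖ ≤ m.prod := by
    have hmem : max 1 ‖z‖ ∈ m := Multiset.mem_map_of_mem _ hroot
    obtain ⟨m', hm'⟩ := Multiset.exists_cons_of_mem hmem
    rw [hm', Multiset.prod_cons]
    refine le_mul_of_one_le_right (by positivity) (Multiset.one_le_prod fun a ha => hm1 a ?_)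
    rw [hm']
    exact Multiset.mem_cons_of_mem ha
  have hprod0 : 0 ≤ |(P.leadingCoeff : ℝ)| * m.prod :=
    mul_nonneg (abs_nonneg _) (le_trans (by positivity) hle)
  have hpow : |(P.leadingCoeff : ℝ)| * m.prod ≤ H ^ P.natDegree := by
    have h1 : (|(P.leadingCoeff : ℝ)| * m.prod) ^ (1 / (P.natDegree : ℝ)) ≤ H := hH
    have h2 := pow_le_pow_left₀ (Real.rpow_nonneg hprod0 _) h1 P.natDegree
    rwa [one_div, Real.rpow_inv_natCast_pow hprod0 hdeg.ne'] at h2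
  calc _ ≤ |(P.leadingCoeff : ℝ)| * m.prod := by gcongr
    _ ≤ H ^ P.natDegree := hpow
    _ ≤ H ^ d := pow_le_pow_right₀ hH1 (by rw [hP, natDegree_intMinpoly hα]; exact hd)

theorem one_le_abs_leadingCoeff_intMinpoly (α : ℂ) :
    1 ≤ |((intMinpoly α).leadingCoeff : ℝ)| := by
  exact_mod_cast Int.one_le_abs (Polynomial.leadingCoeff_ne_zero.2 (intMinpoly_ne_zero α))

theorem norm_le_height_pow {α : ℂ} (hα : IsAlgebraic ℚ α) {d : ℕ} {H : ℝ}
    (hd : (minpoly ℚ α).natDegree ≤ d) (hH1 : 1 ≤ H) (hH : algHeight α ≤ H) : ‖α‖ ≤ H ^ d := by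
  have h1 := leadingCoeff_mul_max_le_height_pow hα hd hH1 hH (minpoly.aeval ℚ α)
  have h2 := one_le_abs_leadingCoeff_intMinpoly α
  have h3 : (1 : ℝ) ≤ max 1 ‖α‖ := le_max_left _ _
  have h4 : ‖α‖ ≤ max 1 ‖α‖ := le_max_right _ _
  nlinarith

/-- A Liouville inequality: a nonzero value of an integer polynomial in two variables at elements
of a number field is not too small. -/
theorem one_le_norm_bivariateEval_mul_of_algHom {E : Type*} [Field E] [Algebra ℚ E]
    [FiniteDimensional ℚ E] (φ : E →ₐ[ℚ] ℂ) (x y : E) {d : ℕ} {H : ℝ}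
    (hd : Module.finrank ℚ E ≤ d) (hH1 : 1 ≤ H) (hHα : algHeight (φ x) ≤ H)
    (hHβ : algHeight (φ y) ≤ H) {T B : ℕ} (hB : 1 ≤ B) {p : Fin (T + 1) × Fin (T + 1) → ℤ}
    (hp : ∀ i, |p i| ≤ B) (hne : bivariateEval p (φ x) (φ y) ≠ 0) :
    1 ≤ ‖bivariateEval p (φ x) (φ y)‖ * (((T : ℝ) + 1) ^ 2 * B * H ^ (2 * d * T)) ^ d := by
  classical
  have hxmin : minpoly ℚ x = minpoly ℚ (φ x) := (minpoly.algHom_eq φ φ.injective x).symm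
  have hymin : minpoly ℚ y = minpoly ℚ (φ y) := (minpoly.algHom_eq φ φ.injective y).symm
  have hα : IsAlgebraic ℚ (φ x) := ((IsIntegral.of_finite ℚ x).map φ).isAlgebraic
  have hβ : IsAlgebraic ℚ (φ y) := ((IsIntegral.of_finite ℚ y).map φ).isAlgebraic
  have hdα : (minpoly ℚ (φ x)).natDegree ≤ d := by
    rw [← hxmin]; exact (minpoly.natDegree_le x).trans hd
  have hdβ : (minpoly ℚ (φ y)).natDegree ≤ d := by
    rw [← hymin]; exact (minpoly.natDegree_le y).trans hd
  set α := φ x with hαdef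
  set β := φ y with hβdef
  set a : ℤ := (intMinpoly α).leadingCoeff with ha
  set b : ℤ := (intMinpoly β).leadingCoeff with hb
  have hax : IsIntegral ℤ ((a : E) * x) := by
    have h1 : aeval x (minpoly ℚ α) = 0 := by rw [← hxmin]; exact minpoly.aeval ℚ x
    have := isIntegral_leadingCoeff_smul (intMinpoly α) x (aeval_intMinpoly_eq_zero hα h1)
    rwa [zsmul_eq_mul] at this
  have hby : IsIntegral ℤ ((b : E) * y) := by
    have h1 : aeval y (minpoly ℚ β) = 0 := by rw [← hymin]; exact minpoly.aeval ℚ y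
    have := isIntegral_leadingCoeff_smul (intMinpoly β) y (aeval_intMinpoly_eq_zero hβ h1)
    rwa [zsmul_eq_mul] at this
  -- The leading coefficients a and b clear the denominators of x and y, so γ = a^T b^T P(x, y) is
  -- an algebraic integer. Its norm is a nonzero integer, of absolute value at least 1, while every
  -- conjugate is at most W.
  let γ : E := ∑ i, (p i : E) * (((a : E) ^ T * x ^ (i.1 : ℕ)) * ((b : E) ^ T * y ^ (i.2 : ℕ)))
  have hint : ∀ n : ℤ, IsIntegral ℤ (n : E) := fun n => isIntegral_algebraMap (x := n)
  have hterm : ∀ (n : ℤ) (w : E) (j : Fin (T + 1)), IsIntegral ℤ ((n : E) * w) →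
      IsIntegral ℤ ((n : E) ^ T * w ^ (j : ℕ)) := by
    intro n w j hw
    have h1 : (n : E) ^ T * w ^ (j : ℕ) = (n : E) ^ (T - (j : ℕ)) * ((n : E) * w) ^ (j : ℕ) := by
      rw [mul_pow, ← mul_assoc, ← pow_add, Nat.sub_add_cancel (Nat.lt_succ_iff.1 j.2)]
    rw [h1]
    exact ((hint n).pow _).mul (hw.pow _)
  have hγint : IsIntegral ℤ γ := IsIntegral.sum _ fun i _ =>
    (hint _).mul ((hterm _ _ _ hax).mul (hterm _ _ _ hby))
  have hσ : ∀ σ : E →ₐ[ℚ] ℂ, σ γ = (a : ℂ) ^ T * (b : ℂ) ^ T * bivariateEval p (σ x) (σ y) := by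
    intro σ
    simp only [γ, bivariateEval, map_sum, map_mul, map_pow, map_intCast, Finset.mul_sum]
    exact Finset.sum_congr rfl fun i _ => by ring
  have ha0 : a ≠ 0 := Polynomial.leadingCoeff_ne_zero.2 (intMinpoly_ne_zero α)
  have hb0 : b ≠ 0 := Polynomial.leadingCoeff_ne_zero.2 (intMinpoly_ne_zero β)
  have hγ0 : γ ≠ 0 := by
    intro h
    have h1 := hσ φ
    rw [h, map_zero] at h1
    have h2 : (a : ℂ) ^ T * (b : ℂ) ^ T ≠ 0 :=
      mul_ne_zero (pow_ne_zero _ (by exact_mod_cast ha0)) (pow_ne_zero _ (by exact_mod_cast hb0))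
    exact mul_ne_zero h2 hne h1.symm
  obtain ⟨N, hN⟩ := IsIntegrallyClosed.isIntegral_iff.1 (Algebra.isIntegral_norm ℚ hγint)
  have hN0 : N ≠ 0 := by
    rintro rfl
    rw [map_zero] at hN
    exact Algebra.norm_ne_zero_iff.2 hγ0 hN.symm
  have hprod : 1 ≤ ∏ σ : E →ₐ[ℚ] ℂ, ‖σ γ‖ := by
    have h1 := Algebra.norm_eq_prod_embeddings ℚ ℂ γ
    rw [← norm_prod, ← h1, ← hN]
    simp only [eq_intCast, map_intCast, Complex.norm_intCast]
    exact_mod_cast Int.one_le_abs hN0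
  set W : ℝ := ((T : ℝ) + 1) ^ 2 * B * H ^ (2 * d * T) with hW
  have hB1 : (1 : ℝ) ≤ B := by exact_mod_cast hB
  have hT1 : (1 : ℝ) ≤ ((T : ℝ) + 1) ^ 2 :=
    one_le_pow₀ (by linarith [Nat.cast_nonneg (α := ℝ) T])
  have hTB : (1 : ℝ) ≤ ((T : ℝ) + 1) ^ 2 * B := one_le_mul_of_one_le_of_one_le hT1 hB1
  have hHd : (1 : ℝ) ≤ H ^ (2 * d * T) := one_le_pow₀ hH1
  have hW1 : 1 ≤ W := one_le_mul_of_one_le_of_one_le hTB hHd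
  have hconj : ∀ (n : ℤ) (w : ℂ) (j : Fin (T + 1)), |(n : ℝ)| * max 1 ‖w‖ ≤ H ^ d →
      ‖(n : ℂ) ^ T * w ^ (j : ℕ)‖ ≤ H ^ (d * T) := by
    intro n w j h
    rw [norm_mul, norm_pow, norm_pow, Complex.norm_intCast, pow_mul]
    calc |(n : ℝ)| ^ T * ‖w‖ ^ (j : ℕ) ≤ |(n : ℝ)| ^ T * (max 1 ‖w‖) ^ T := by
          gcongr
          exact (pow_le_pow_left₀ (norm_nonneg _) (le_max_right _ _) _).trans
            (pow_le_pow_right₀ (le_max_left _ _) (Nat.lt_succ_iff.1 j.2))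
      _ = (|(n : ℝ)| * max 1 ‖w‖) ^ T := by rw [mul_pow]
      _ ≤ _ := by gcongr
  have hσle : ∀ σ : E →ₐ[ℚ] ℂ, ‖σ γ‖ ≤ W := by
    intro σ
    have hx := leadingCoeff_mul_max_le_height_pow hα hdα hH1 hHα (z := σ x)
      (by rw [← hxmin]; exact minpoly.aeval_algHom ℚ σ x)
    have hy := leadingCoeff_mul_max_le_height_pow hβ hdβ hH1 hHβ (z := σ y)
      (by rw [← hymin]; exact minpoly.aeval_algHom ℚ σ y)
    simp only [γ, map_sum, map_mul, map_pow, map_intCast]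
    calc _ ≤ ∑ i : Fin (T + 1) × Fin (T + 1), ‖(p i : ℂ) * (((a : ℂ) ^ T * σ x ^ (i.1 : ℕ)) *
            ((b : ℂ) ^ T * σ y ^ (i.2 : ℕ)))‖ := norm_sum_le _ _
      _ ≤ ∑ _i : Fin (T + 1) × Fin (T + 1), (B : ℝ) * (H ^ (d * T) * H ^ (d * T)) := by
          refine Finset.sum_le_sum fun i _ => ?_
          rw [norm_mul, norm_mul, Complex.norm_intCast]
          have h1 : |(p i : ℝ)| ≤ B := by exact_mod_cast hp i
          exact mul_le_mul h1 (mul_le_mul (hconj _ _ _ hx) (hconj _ _ _ hy) (norm_nonneg _)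
            (by positivity)) (by positivity) (by positivity)
      _ = W := by
          simp only [Finset.sum_const, Finset.card_univ, Fintype.card_prod, Fintype.card_fin,
            nsmul_eq_mul, ← pow_add, hW]
          push_cast
          ring
  have hval : ‖φ γ‖ ≤ W * ‖bivariateEval p α β‖ := by
    have h1 : φ γ = (a : ℂ) ^ T * (b : ℂ) ^ T * bivariateEval p α β := hσ φ
    rw [h1, norm_mul]
    gcongr
    -- The exponent index 0 turns `hconj` into a bound for |a|^T alone.
    have hx := hconj _ _ 0 (leadingCoeff_mul_max_le_height_pow hα hdα hH1 hHα (minpoly.aeval ℚ α))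
    have hy := hconj _ _ 0 (leadingCoeff_mul_max_le_height_pow hβ hdβ hH1 hHβ (minpoly.aeval ℚ β))
    simp only [Fin.val_zero, pow_zero, mul_one] at hx hy
    rw [norm_mul]
    calc _ ≤ H ^ (d * T) * H ^ (d * T) := by gcongr
      _ = H ^ (2 * d * T) := by rw [← pow_add]; ring_nf
      _ ≤ W := le_mul_of_one_le_left (by positivity) hTB
  have hcard : Fintype.card (E →ₐ[ℚ] ℂ) ≤ d := by rw [AlgHom.card]; exact hd
  rw [← Finset.mul_prod_erase _ _ (Finset.mem_univ φ)] at hprod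
  have hcpos : 0 < Fintype.card (E →ₐ[ℚ] ℂ) := Fintype.card_pos_iff.2 ⟨φ⟩
  calc 1 ≤ ‖φ γ‖ * ∏ σ ∈ Finset.univ.erase φ, ‖σ γ‖ := hprod
    _ ≤ (W * ‖bivariateEval p α β‖) * W ^ (Fintype.card (E →ₐ[ℚ] ℂ) - 1) := by
        gcongr
        refine (Finset.prod_le_prod (fun _ _ => norm_nonneg _) fun σ _ => hσle σ).trans
          (le_of_eq ?_)
        rw [Finset.prod_const, Finset.card_erase_of_mem (Finset.mem_univ _), Finset.card_univ]
    _ = ‖bivariateEval p α β‖ * W ^ (Fintype.card (E →ₐ[ℚ] ℂ)) := by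
        rw [mul_comm W, mul_assoc, ← pow_succ', Nat.sub_add_cancel hcpos]
    _ ≤ _ := by gcongr

/-- A Liouville inequality: a nonzero value of an integer polynomial in two variables at algebraic
numbers of bounded degree and height is not too small. -/
theorem one_le_norm_bivariateEval_mul {α β : ℂ} (hα : IsAlgebraic ℚ α) (hβ : IsAlgebraic ℚ β)
    {d : ℕ} {H : ℝ} (hd : Module.finrank ℚ (IntermediateField.adjoin ℚ ({α, β} : Set ℂ)) ≤ d)
    (hH1 : 1 ≤ H) (hHα : algHeight α ≤ H) (hHβ : algHeight β ≤ H) {T B : ℕ} (hB : 1 ≤ B)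
    {p : Fin (T + 1) × Fin (T + 1) → ℤ} (hp : ∀ i, |p i| ≤ B) (hne : bivariateEval p α β ≠ 0) :
    1 ≤ ‖bivariateEval p α β‖ * (((T : ℝ) + 1) ^ 2 * B * H ^ (2 * d * T)) ^ d := by
  have hfd := IntermediateField.finiteDimensional_adjoin_pair hα.isIntegral hβ.isIntegral
  exact @one_le_norm_bivariateEval_mul_of_algHom _ _ (IntermediateField.algebra' _) hfd
    (IntermediateField.adjoin ℚ ({α, β} : Set ℂ)).val
    ⟨α, IntermediateField.subset_adjoin _ _ (by simp)⟩
    ⟨β, IntermediateField.subset_adjoin _ _ (by simp)⟩ d H hd hH1 hHα hHβ T B hB p hp hne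

theorem natDegree_minpoly_right_le {α β : ℂ} (hα : IsAlgebraic ℚ α) (hβ : IsAlgebraic ℚ β) :
    (minpoly ℚ β).natDegree ≤
      Module.finrank ℚ (IntermediateField.adjoin ℚ ({α, β} : Set ℂ)) := by
  have hfd := IntermediateField.finiteDimensional_adjoin_pair hα.isIntegral hβ.isIntegral
  have hle : IntermediateField.adjoin ℚ ({β} : Set ℂ) ≤
      IntermediateField.adjoin ℚ ({α, β} : Set ℂ) := IntermediateField.adjoin.mono _ _ _ (by simp)
  rw [← IntermediateField.adjoin.finrank hβ.isIntegral]
  exact IntermediateField.finrank_le_of_le_right hle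

/-! ### The auxiliary polynomial. -/

theorem HasDiskGrowth.norm_le_exp {f : ℂ → ℂ} {c₀ N k : ℝ} (hf : HasDiskGrowth f c₀)
    (hN : c₀ ≤ N) (hk : 2 ≤ k) {z : ℂ} (hz : ‖z‖ = 1 - 1 / k) :
    ‖f z‖ ≤ Real.exp (N * k * Real.log k) := by
  have hk0 : 0 < k := by linarith
  have h1 : 1 / k ≤ 1 / 2 := one_div_le_one_div_of_le two_pos hk
  have h2 : 0 < 1 / k := by positivity
  have hphi : diskPhi z = k := by rw [diskPhi, hz]; field_simp; ring
  have h3 := hf.2 z (by linarith) (by linarith)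
  rw [hphi] at h3
  refine h3.trans ?_
  rw [Real.rpow_def_of_pos hk0]
  apply Real.exp_le_exp.2
  have h4 : 0 ≤ Real.log k := Real.log_nonneg (by linarith)
  have h5 : c₀ * k ≤ N * k := by gcongr
  nlinarith

theorem HasDiskGrowth.differentiableOn {f : ℂ → ℂ} {c₀ : ℝ} (hf : HasDiskGrowth f c₀) :
    DifferentiableOn ℂ f (Metric.ball 0 1) := hf.1.differentiableOn

/-- This is the clash of the two estimates, used with A = (T+1)², P = M^T, h = H^(2dT), t = (r/R)^n,
u = 1 - r/R. As B absorbs the other factors, V ≤ B² / B^(2d+3), whereas Liouville gives V ≥ B^(-2d).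
Together B³ ≤ B², which explains the exponent 2d + 3. -/
theorem not_small_of_liouville {K A P h B t u V : ℝ} {d : ℕ} (hK : 2 ≤ K) (hN1 : 1 ≤ A)
    (hMT : 1 ≤ P) (hHT : 1 ≤ h) (hB : 8 * K * A * P * h ≤ B) (ht : t ≤ 1 / B ^ (2 * d + 3))
    (hu : 1 / (2 * K) ≤ u) (hup : V ≤ A * B * P * (2 / B ^ (2 * d + 3) + t) / u)
    (hlow : 1 ≤ V * (A * B * h) ^ d) : False := by
  have hK0 : 0 < K := by linarith
  have hA0 : 0 < A := by linarith
  have hP0 : 0 < P := by linarith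
  have hh0 : 0 < h := by linarith
  have hB16 : 16 ≤ B := by
    have h1 : 1 ≤ A * P * h :=
      one_le_mul_of_one_le_of_one_le (one_le_mul_of_one_le_of_one_le hN1 hMT) hHT
    have h2 : 16 * 1 ≤ 8 * K * (A * P * h) := by gcongr; linarith
    linarith
  have hB0 : 0 < B := by linarith
  have hV0 : 0 ≤ V := by
    by_contra hV
    have h1 : V * (A * B * h) ^ d ≤ 0 :=
      mul_nonpos_of_nonpos_of_nonneg (not_le.1 hV).le (by positivity)
    linarith
  set Q : ℝ := B ^ (2 * d + 3) with hQ
  have hQ0 : 0 < Q := by positivity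
  have hu0 : 0 < u := lt_of_lt_of_le (by positivity) hu
  have h5 : A * B * P * (2 / Q + t) / u ≤
      A * B * P * (2 / Q + 1 / Q) / (1 / (2 * K)) := by
    gcongr
  have h6 : A * B * P * (2 / Q + 1 / Q) / (1 / (2 * K)) =
      6 * K * A * P * B / Q := by
    field_simp; ring
  have h7 : 6 * K * A * P ≤ B := by
    have h8 : 8 * K * A * P * 1 ≤
        8 * K * A * P * h := by gcongr
    have h9 : 0 ≤ K * A * P := by positivity
    linarith
  have h10 : V * Q ≤ B ^ 2 := by
    have h11 : V ≤ 6 * K * A * P * B / Q := by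
      rw [← h6]; exact hup.trans h5
    rw [le_div_iff₀ hQ0] at h11
    calc V * Q ≤ 6 * K * A * P * B := h11
      _ ≤ B * B := by gcongr
      _ = _ := (sq _).symm
  have h12 : A * B * h ≤ B ^ 2 := by
    have h13 : A * h ≤ B := by
      have h14 : 1 ≤ 8 * K * P := one_le_mul_of_one_le_of_one_le (by linarith) hMT
      calc A * h
          = 1 * (A * h) := (one_mul _).symm
        _ ≤ 8 * K * P * (A * h) := by gcongr
        _ = 8 * K * A * P * h := by ring
        _ ≤ B := hB
    calc _ = A * h * B := by ring
      _ ≤ B * B := by gcongr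
      _ = _ := (sq _).symm
  have h15 : 1 ≤ V * B ^ (2 * d) := by
    refine hlow.trans ?_
    rw [pow_mul B 2 d]
    gcongr
  have h16 : Q = B ^ (2 * d) * B ^ 3 := by rw [hQ, pow_add]
  have h17 : B ^ 3 ≤ B ^ 2 := by
    calc B ^ 3 = 1 * B ^ 3 := (one_mul _).symm
      _ ≤ V * B ^ (2 * d) * B ^ 3 := by gcongr
      _ = V * Q := by rw [h16]; ring
      _ ≤ _ := h10
  have h18 : B ^ 3 = B ^ 2 * B := by ring
  nlinarith [pow_pos hB0 2]

/-- An auxiliary polynomial vanishing at all algebraic points `(α, f α)` of bounded degree and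
height with `α` in a fixed disk. -/
theorem exists_bivariateEval_eq_zero {f : ℂ → ℂ} {c₀ N : ℝ} (hf : HasDiskGrowth f c₀)
    (hN : c₀ ≤ N) {K : ℝ} (hK : 2 ≤ K) {d T B n : ℕ} {H M : ℝ} (hH : 1 ≤ H)
    (hM1 : 1 ≤ M) (hM : Real.exp (N * (2 * K) * Real.log (2 * K)) ≤ M)
    (hB : 8 * K * ((T : ℝ) + 1) ^ 2 * M ^ T * H ^ (2 * d * T) ≤ B)
    (hn : (2 * d + 3) * Real.log B ≤ n / (2 * K)) (hT : 2 * n * (2 * d + 3 + 1) ≤ (T + 1) ^ 2) :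
    ∃ p : Fin (T + 1) × Fin (T + 1) → ℤ, p ≠ 0 ∧ (∀ i, |p i| ≤ B) ∧
      ∀ α : ℂ, ‖α‖ ≤ 1 - 1 / K → IsAlgebraic ℚ α → IsAlgebraic ℚ (f α) →
        Module.finrank ℚ (IntermediateField.adjoin ℚ ({α, f α} : Set ℂ)) ≤ d →
        algHeight α ≤ H → algHeight (f α) ≤ H → bivariateEval p α (f α) = 0 := by
  have hK0 : 0 < K := by linarith
  set R : ℝ := 1 - 1 / (2 * K) with hR
  set r : ℝ := 1 - 1 / K with hr
  have hKi : 1 / K ≤ 1 / 2 := one_div_le_one_div_of_le two_pos hK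
  have hKp : 0 < 1 / K := by positivity
  have h2K : 1 / (2 * K) = 1 / K / 2 := by field_simp
  have hRr : R - r = 1 / (2 * K) := by rw [hR, hr, h2K]; ring
  have hR0 : 0 < R := by rw [hR, h2K]; linarith
  have hR1 : R < 1 := by rw [hR, h2K]; linarith
  have hr0 : 0 ≤ r := by rw [hr]; linarith
  have hrR : r < R := by rw [hR, hr, h2K]; linarith
  have hMT : 1 ≤ M ^ T := one_le_pow₀ hM1
  have hN1 : (1 : ℝ) ≤ ((T : ℝ) + 1) ^ 2 :=
    one_le_pow₀ (by linarith [Nat.cast_nonneg (α := ℝ) T])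
  have hHT : 1 ≤ H ^ (2 * d * T) := one_le_pow₀ hH
  have hprod : 1 ≤ M ^ T * H ^ (2 * d * T) := one_le_mul_of_one_le_of_one_le hMT hHT
  have hB16 : (16 : ℝ) ≤ B := by
    have h1 : 1 ≤ ((T : ℝ) + 1) ^ 2 * (M ^ T * H ^ (2 * d * T)) :=
      one_le_mul_of_one_le_of_one_le hN1 hprod
    nlinarith
  have hB3 : 3 ≤ B := by
    have : (3 : ℝ) ≤ B := by linarith
    exact_mod_cast this
  have hB0 : (0 : ℝ) < B := by linarith
  have hfR : ∀ z : ℂ, ‖z‖ = R → ‖f z‖ ≤ M := fun z hz =>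
    (hf.norm_le_exp hN (by linarith : 2 ≤ 2 * K) hz).trans hM
  obtain ⟨p, hp0, hpB, hp⟩ := exists_int_combination_small
    (g := fun (i : Fin (T + 1) × Fin (T + 1)) z => z ^ (i.1 : ℕ) * f z ^ (i.2 : ℕ))
    (fun i => (differentiableOn_id.pow _).mul (hf.differentiableOn.pow _))
    (M := M ^ T) (by positivity) hR0 hR1 hr0 hrR (fun i z hz => by
      rw [norm_mul, norm_pow, norm_pow]
      have h1 : ‖z‖ ^ (i.1 : ℕ) ≤ 1 := pow_le_one₀ (norm_nonneg _) (by linarith)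
      have h2 : ‖f z‖ ^ (i.2 : ℕ) ≤ M ^ T := (pow_le_pow_left₀ (norm_nonneg _) (hfR z hz) _).trans
            (pow_le_pow_right₀ hM1 (Nat.lt_succ_iff.1 i.2.2))
      calc _ ≤ 1 * M ^ T := by gcongr
        _ = _ := one_mul _) (B := B) (s := 2 * d + 3) (n := n) hB3
      (by simp) (by simpa [sq] using hT)
  refine ⟨p, hp0, hpB, fun α hαr hα hfα hdeg hHα hHf => ?_⟩
  by_contra hne
  have hlow := one_le_norm_bivariateEval_mul hα hfα hdeg hH hHα hHf (by omega : 1 ≤ B) hpB hne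
  have hup := hp α hαr
  change ‖bivariateEval p α (f α)‖ ≤ _ at hup
  set V := ‖bivariateEval p α (f α)‖ with hV
  have hcard : ((Fintype.card (Fin (T + 1) × Fin (T + 1)) : ℕ) : ℝ) = ((T : ℝ) + 1) ^ 2 := by
    simp [sq]
  rw [hcard] at hup
  -- Since R < 1, r/R ≤ 1 - (R - r). The n-th power is then at most exp(-n/(2K)), which `hn`
  -- compares with B^(-(2d+3)).
  have hθle : r / R ≤ 1 - 1 / (2 * K) := by
    rw [← hRr, div_le_iff₀ hR0]
    nlinarith
  have hθpow : (r / R) ^ n ≤ 1 / (B : ℝ) ^ (2 * d + 3) := by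
    have h1 : r / R ≤ Real.exp (-(1 / (2 * K))) := by
      linarith [Real.add_one_le_exp (-(1 / (2 * K)))]
    calc (r / R) ^ n ≤ Real.exp (-(1 / (2 * K))) ^ n :=
          pow_le_pow_left₀ (by positivity) h1 n
      _ = Real.exp (-(n / (2 * K))) := by rw [← Real.exp_nat_mul]; congr 1; ring
      _ ≤ Real.exp (-((2 * d + 3) * Real.log B)) := by
          apply Real.exp_le_exp.2; linarith
      _ = 1 / (B : ℝ) ^ (2 * d + 3) := by
          rw [Real.exp_neg, one_div]
          congr 1
          rw [show (2 * (d : ℝ) + 3) = ((2 * d + 3 : ℕ) : ℝ) by push_cast; ring, Real.exp_nat_mul,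
            Real.exp_log hB0]
  exact not_small_of_liouville hK hN1 hMT hHT hB hθpow (by linarith) hup hlow

/-! ### The zero estimate. -/

/-- A zero estimate for `P(z, f z)` in a disk, where `f` grows fast along the radius `(0, 1)`. -/
theorem exists_card_zeros_bivariateEval_le {f : ℂ → ℂ} {c₀ N a b l : ℝ} (hf : HasDiskGrowth f c₀)
    (hN : c₀ ≤ N) (hN0 : 0 ≤ N) (ha : 0 < a) (hl : 0 < l) (hb : 1 < b) (hbl : 1 ≤ l * Real.log b)
    (hal : -l ≤ Real.log a)
    (hlow : ∀ x : ℝ, 0 < x → x < 1 → a * b ^ diskPhi (x : ℂ) ≤ ‖f (x : ℂ)‖)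
    {T B m₀ : ℕ} (hB : 1 ≤ B) {K : ℝ} (hK : 2 ≤ K) (hKm : K ≤ m₀)
    (hm₀ : ∀ m : ℕ, m₀ ≤ m → m ≤ m₀ + T →
      Real.log (2 * ((T : ℝ) + 1) ^ 2 * B * (m : ℝ) ^ T) ≤ m / l - l)
    {p : Fin (T + 1) × Fin (T + 1) → ℤ} (hp0 : p ≠ 0) (hp : ∀ i, |p i| ≤ B) (s : Finset ℂ)
    (hs : ∀ w ∈ s, ‖w‖ ≤ 1 - 1 / K ∧ bivariateEval p w (f w) = 0) :
    ∃ m : ℕ, m₀ ≤ m ∧ m ≤ m₀ + T ∧ (s.card : ℝ) ≤ 32 * m * K *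
      (Real.log (2 * ((T : ℝ) + 1) ^ 2 * B * (m : ℝ) ^ T) +
        T * (N * (2 * m) * Real.log (2 * m))) := by
  have hK0 : 0 < K := by linarith
  have hm₀1 : 1 ≤ m₀ := by
    have : (1 : ℝ) ≤ m₀ := by linarith
    exact_mod_cast this
  obtain ⟨m, hm1, hm2, hm⟩ := exists_bivariateEval_lower_bound hp0 hp hm₀1
  refine ⟨m, hm1, hm2, ?_⟩
  have hKm' : K ≤ m := hKm.trans (by exact_mod_cast hm1)
  have hm2r : (2 : ℝ) ≤ m := hK.trans hKm'
  have hm0 : (0 : ℝ) < m := by linarith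
  set x : ℝ := 1 - 1 / (m : ℝ) with hx
  have hmi : 1 / (m : ℝ) ≤ 1 / 2 := one_div_le_one_div_of_le two_pos hm2r
  have hmp : 0 < 1 / (m : ℝ) := by positivity
  have hx0 : 0 < x := by rw [hx]; linarith
  have hx1 : x < 1 := by rw [hx]; linarith
  have hxn : ‖(x : ℂ)‖ = x := by rw [Complex.norm_real, Real.norm_eq_abs, abs_of_pos hx0]
  have hxc : (x : ℂ) = 1 - 1 / (m : ℂ) := by rw [hx]; push_cast; rfl
  have hphi : diskPhi (x : ℂ) = m := by
    rw [diskPhi, hxn, hx]; field_simp; ring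
  set G : ℝ := 2 * ((T : ℝ) + 1) ^ 2 * B * (m : ℝ) ^ T with hG
  have hB1 : (1 : ℝ) ≤ B := by exact_mod_cast hB
  have hN1 : (1 : ℝ) ≤ ((T : ℝ) + 1) ^ 2 :=
    one_le_pow₀ (by linarith [Nat.cast_nonneg (α := ℝ) T])
  have hmT : (1 : ℝ) ≤ (m : ℝ) ^ T := one_le_pow₀ (by linarith)
  have hG1 : 1 ≤ G := by
    have h1 := one_le_mul_of_one_le_of_one_le (one_le_mul_of_one_le_of_one_le hN1 hB1) hmT
    rw [hG]; nlinarith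
  have hG0 : 0 < G := by linarith
  -- From l·log b ≥ 1 and log a ≥ -l one gets a·b^m ≥ exp(m/l - l), and `hm₀` puts this above the
  -- threshold G at which the top power of y dominates.
  have hfx : G ≤ ‖f x‖ := by
    have h1 := hlow x hx0 hx1
    rw [hphi] at h1
    refine le_trans ?_ h1
    have h2 : a * b ^ (m : ℝ) = Real.exp (Real.log a + m * Real.log b) := by
      rw [Real.exp_add, Real.exp_log ha, Real.rpow_def_of_pos (by linarith), mul_comm (m : ℝ)]
    rw [h2, ← Real.exp_log hG0]
    apply Real.exp_le_exp.2
    have h3 := hm₀ m hm1 hm2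
    have h4 : (m : ℝ) / l ≤ m * Real.log b := by
      rw [div_le_iff₀ hl]
      nlinarith
    linarith
  have hFx := hm (f x) hfx (hG1.trans hfx)
  rw [← hxc] at hFx
  -- The circle lies halfway between x and the unit circle. The gaps R - x = 1/(2m) and R - (1 -
  -- 1/K) ≥ 1/(2K) make each zero contribute a factor exp(-1/(32mK)).
  set R : ℝ := 1 - 1 / (2 * (m : ℝ)) with hR
  have h2m : 1 / (2 * (m : ℝ)) = 1 / m / 2 := by field_simp
  have hR0 : 0 < R := by rw [hR, h2m]; linarith
  have hR1 : R < 1 := by rw [hR, h2m]; linarith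
  have hKi : 1 / (m : ℝ) ≤ 1 / K := one_div_le_one_div_of_le hK0 hKm'
  set E : ℝ := N * (2 * m) * Real.log (2 * m) with hE
  have hE0 : 0 ≤ E := by
    have : 0 ≤ Real.log (2 * m) := Real.log_nonneg (by linarith)
    positivity
  have hM : ∀ z : ℂ, ‖z‖ = R → ‖bivariateEval p z (f z)‖ ≤
      ((T : ℝ) + 1) ^ 2 * B * Real.exp E ^ T := fun z hz =>
    norm_bivariateEval_le hp (Real.one_le_exp hE0) (by linarith)
      (hf.norm_le_exp hN (by linarith) hz)
  have hdiff : DifferentiableOn ℂ (fun z => bivariateEval p z (f z)) (Metric.ball 0 1) := by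
    refine DifferentiableOn.fun_sum fun i _ => ?_
    exact (((differentiableOn_id.pow _).mul (hf.differentiableOn.pow _)).const_mul _)
  have hJ := norm_le_mul_exp_neg_card_zeros hdiff hR0 hR1 (r := 1 - 1 / K)
    (by rw [hR, h2m]; linarith) hM s hs (x := (x : ℂ))
    (by rw [hxn, hR, hx, h2m]; linarith)
  rw [hxn] at hJ
  have hRx : R - x = 1 / (2 * m) := by rw [hR, hx, h2m]; ring
  have hRr : 1 / (2 * K) ≤ R - (1 - 1 / K) := by
    have : 1 / (2 * K) = 1 / K / 2 := by field_simp
    rw [hR, h2m, this]; linarith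
  have hexp : s.card * (1 / (32 * m * K)) ≤ s.card * ((R - x) * (R - (1 - 1 / K)) / 8) := by
    rw [hRx]
    have h1 : 1 / (32 * m * K) = (1 / (2 * m)) * (1 / (2 * K)) / 8 := by field_simp; norm_num
    rw [h1]
    gcongr
  have hfin : 1 ≤ Real.exp (Real.log G + T * E - s.card * (1 / (32 * m * K))) := by
    calc 1 ≤ ‖bivariateEval p x (f x)‖ * (2 * (m : ℝ) ^ T) := hFx
      _ ≤ (((T : ℝ) + 1) ^ 2 * B * Real.exp E ^ T *
          Real.exp (-(s.card * ((R - x) * (R - (1 - 1 / K)) / 8)))) * (2 * (m : ℝ) ^ T) := by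
          gcongr
      _ ≤ (((T : ℝ) + 1) ^ 2 * B * Real.exp E ^ T *
          Real.exp (-(s.card * (1 / (32 * m * K))))) * (2 * (m : ℝ) ^ T) := by
          gcongr
      _ = _ := by
          rw [sub_eq_add_neg, Real.exp_add, Real.exp_add, Real.exp_log hG0, hG, Real.exp_nat_mul]
          ring
  have h0 : 0 ≤ Real.log G + T * E - s.card * (1 / (32 * m * K)) :=
    Real.exp_le_exp.1 (by rwa [Real.exp_zero])
  have hpos : 0 < 32 * (m : ℝ) * K := by positivity
  have h1 : s.card * (1 / (32 * m * K)) ≤ Real.log G + T * E := by linarith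
  rw [mul_one_div, div_le_iff₀ hpos] at h1
  linarith

/-! ### Choice of parameters and the count in a disk. -/

theorem one_le_log_two_mul {K : ℝ} (hK : 2 ≤ K) : 1 ≤ Real.log (2 * K) := by
  rw [Real.le_log_iff_exp_le (by linarith)]
  linarith [Real.exp_one_lt_d9]

/-- Apply log t ≤ t at t = √x. It serves to replace (log 2K)² by a multiple of K, so that the count
is a pure power of K. -/
theorem log_sq_le_four_mul {x : ℝ} (hx : 1 ≤ x) : Real.log x ^ 2 ≤ 4 * x := by
  have h0 : 0 ≤ x := by linarith
  have h1 : Real.log (Real.sqrt x) = Real.log x / 2 := Real.log_sqrt h0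
  have h2 : Real.log (Real.sqrt x) ≤ Real.sqrt x := Real.log_le_self (Real.sqrt_nonneg x)
  have h3 : 0 ≤ Real.log x := Real.log_nonneg hx
  have h4 : Real.sqrt x ^ 2 = x := Real.sq_sqrt h0
  nlinarith [Real.sqrt_nonneg x]

/-- X is the common logarithmic scale: the factors contribute 2 + λ, 2T, 2X and 2KT to the exponent,
and each of 1, λ, T, KT is at most X. -/
theorem coefficient_size_le {N K lam X H : ℝ} {T d : ℕ} (hK : 2 ≤ K)
    (hlam : lam = Real.log (2 * K)) (hXT : K * T ≤ X) (hTX : (T : ℝ) ≤ X) (hlamX : lam ≤ X)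
    (hX1 : 1 ≤ X) (hX : X = N * K * T * lam) (hH0 : 0 < H) (hHK : d * Real.log H ≤ K) :
    8 * K * ((T : ℝ) + 1) ^ 2 * Real.exp (N * (2 * K) * lam) ^ T * H ^ (2 * d * T) ≤
      Real.exp (9 * X) := by
  have h1 : 8 * K ≤ Real.exp (2 + lam) := by
    rw [Real.exp_add, hlam, Real.exp_log (by linarith)]
    have h2 : (4 : ℝ) ≤ Real.exp 2 := by
      rw [show (2 : ℝ) = 1 + 1 by norm_num, Real.exp_add]
      nlinarith [Real.exp_one_gt_d9]
    linarith [mul_le_mul_of_nonneg_right h2 (by linarith : 0 ≤ 2 * K)]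
  have h2 : ((T : ℝ) + 1) ^ 2 ≤ Real.exp (2 * T) := by
    have h3 : Real.exp (2 * T) = Real.exp T ^ 2 := by rw [← Real.exp_nat_mul]; norm_num
    rw [h3]
    exact pow_le_pow_left₀ (by positivity) (Real.add_one_le_exp _) 2
  have h3 : Real.exp (N * (2 * K) * lam) ^ T = Real.exp (2 * X) := by
    rw [← Real.exp_nat_mul, hX]; ring_nf
  have h4 : H ^ (2 * d * T) ≤ Real.exp (2 * (K * T)) := by
    rw [← Real.exp_log hH0, ← Real.exp_nat_mul, Real.exp_le_exp]
    push_cast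
    have : (d * Real.log H) * T ≤ K * T := by gcongr
    linarith
  calc _ ≤ Real.exp (2 + lam) * Real.exp (2 * T) * Real.exp (2 * X) *
        Real.exp (2 * (K * T)) := by
        rw [h3]; gcongr
    _ = Real.exp (2 + lam + 2 * T + 2 * X + 2 * (K * T)) := by
        simp only [← Real.exp_add]
    _ ≤ _ := by
        apply Real.exp_le_exp.2
        linarith

/-- The left side is a crude bound for 2m at the chosen parameters. The lemma yields log(2m) ≤ 24Nλ.
-/
theorem le_exp_of_param {N K lam : ℝ} (hN : 1 ≤ N) (hK : 2 ≤ K) (hlam : lam = Real.log (2 * K)) :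
    407568 * N ^ 2 * K ^ 8 ≤ Real.exp (24 * N * lam) := by
  have hN0 : 0 < N := by linarith
  have hK0 : 0 < K := by linarith
  have hlam1 : 1 ≤ lam := hlam ▸ one_le_log_two_mul hK
  have h3 : (407568 : ℝ) ≤ Real.exp 14 := by
    have h4 : Real.exp 14 = Real.exp 1 ^ 14 := by rw [← Real.exp_nat_mul]; norm_num
    rw [h4]
    calc (407568 : ℝ) ≤ 2.7 ^ 14 := by norm_num
      _ ≤ _ := by gcongr; linarith [Real.exp_one_gt_d9]
  have h5 : N ^ 2 ≤ Real.exp (2 * N) := by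
    have h4 : Real.exp (2 * N) = Real.exp N ^ 2 := by rw [← Real.exp_nat_mul]; norm_num
    rw [h4]
    exact pow_le_pow_left₀ hN0.le (by linarith [Real.add_one_le_exp N]) 2
  have h6 : K ^ 8 ≤ Real.exp (8 * lam) := by
    have h4 : Real.exp (8 * lam) = Real.exp lam ^ 8 := by rw [← Real.exp_nat_mul]; norm_num
    rw [h4, hlam, Real.exp_log (by linarith)]
    exact pow_le_pow_left₀ hK0.le (by linarith) 8
  calc 407568 * N ^ 2 * K ^ 8 ≤ Real.exp 14 * Real.exp (2 * N) * Real.exp (8 * lam) := by gcongr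
    _ = Real.exp (14 + 2 * N + 8 * lam) := by simp only [← Real.exp_add]
    _ ≤ _ := by
        apply Real.exp_le_exp.2
        nlinarith

/-- Up to constants the count is N²K(Tλ)m² with m at most l·X = l·N·K·T·λ, hence cubic in Tλ. Then
Tλ ≤ 9704·N·d²·K³ gives the power K^3·K^9 = K^12. -/
theorem card_bound_arith {N K T l d X lam m g c M : ℝ} (hN : 1 ≤ N) (hK : 2 ≤ K) (hT : 1 ≤ T)
    (hl : 1 ≤ l) (hlam : 1 ≤ lam) (hX : X = N * K * T * lam)
    (hm : m ≤ 42 * l * X) (hXm : X ≤ m) (hg : g ≤ 37 * X) (hM : M ≤ 24 * N * lam)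
    (hT2 : T ≤ 1213 * N * d ^ 2 * K ^ 2 * lam) (hlam2 : lam ^ 2 ≤ 8 * K)
    (hc : c ≤ 32 * m * K * (g + T * (N * (2 * m) * M))) :
    c ≤ 10 ^ 19 * N ^ 7 * l ^ 2 * d ^ 6 * K ^ 12 := by
  have hN0 : 0 < N := by linarith
  have hK0 : 0 < K := by linarith
  have hT0 : 0 < T := by linarith
  have hl0 : 0 < l := by linarith
  have hlam0 : 0 < lam := by linarith
  have hX0 : 0 < X := by rw [hX]; positivity
  have hm0 : 0 < m := by linarith
  have hNTl : 1 ≤ N ^ 2 * T * lam :=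
    one_le_mul_of_one_le_of_one_le (one_le_mul_of_one_le_of_one_le (one_le_pow₀ hN) hT) hlam
  have h1 : g ≤ 37 * (m * (N ^ 2 * T * lam)) := by
    have : m * 1 ≤ m * (N ^ 2 * T * lam) := by gcongr
    linarith
  have h2 : T * (N * (2 * m) * M) ≤ 48 * (m * (N ^ 2 * T * lam)) := by
    calc T * (N * (2 * m) * M) ≤ T * (N * (2 * m) * (24 * N * lam)) := by gcongr
      _ = _ := by ring
  have h3 : T * lam ≤ 9704 * N * d ^ 2 * K ^ 3 := by
    calc T * lam ≤ 1213 * N * d ^ 2 * K ^ 2 * lam * lam := by gcongr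
      _ = 1213 * N * d ^ 2 * K ^ 2 * lam ^ 2 := by ring
      _ ≤ 1213 * N * d ^ 2 * K ^ 2 * (8 * K) := by gcongr
      _ = _ := by ring
  have h4 : m ^ 2 ≤ (42 * l * X) ^ 2 := by gcongr
  calc c ≤ 32 * m * K * (g + T * (N * (2 * m) * M)) := hc
    _ ≤ 32 * m * K * (37 * (m * (N ^ 2 * T * lam)) + 48 * (m * (N ^ 2 * T * lam))) := by gcongr
    _ = 2720 * N ^ 2 * K * (T * lam) * m ^ 2 := by ring
    _ ≤ 2720 * N ^ 2 * K * (T * lam) * (42 * l * X) ^ 2 := by gcongr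
    _ = 4798080 * N ^ 4 * l ^ 2 * K ^ 3 * (T * lam) ^ 3 := by rw [hX]; ring
    _ ≤ 4798080 * N ^ 4 * l ^ 2 * K ^ 3 * (9704 * N * d ^ 2 * K ^ 3) ^ 3 := by gcongr
    _ = 4384497718299525120 * (N ^ 7 * l ^ 2 * d ^ 6 * K ^ 12) := by ring
    _ ≤ 10 ^ 19 * (N ^ 7 * l ^ 2 * d ^ 6 * K ^ 12) := by
        have : 0 ≤ N ^ 7 * l ^ 2 * d ^ 6 * K ^ 12 := by positivity
        nlinarith
    _ = _ := by ring

/-- The algebraic points `α` in the disk of radius `1 - 1 / K` with `f α` algebraic, and degree and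
heights bounded by `d` and `H`. -/
def diskAlgebraicPoints (f : ℂ → ℂ) (K : ℝ) (d : ℕ) (H : ℝ) : Set ℂ :=
  {α | ‖α‖ ≤ 1 - 1 / K ∧ IsAlgebraic ℚ α ∧ IsAlgebraic ℚ (f α) ∧
    Module.finrank ℚ (IntermediateField.adjoin ℚ ({α, f α} : Set ℂ)) ≤ d ∧
    algHeight α ≤ H ∧ algHeight (f α) ≤ H}

/-- All parameters follow from X = NKTλ. Coefficients of size e^(9X) suffice, so the number n of
Taylor coefficients is of order dKX. The pigeonhole step needs T² to exceed a multiple of dn, that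
is of N·d²·K²·λ·T, which fixes T. The top power of y dominates once m/l exceeds a multiple of X,
which fixes m₀. -/
theorem card_diskAlgebraicPoints_le {f : ℂ → ℂ} {c₀ N a b l K H : ℝ} {d : ℕ}
    (hf : HasDiskGrowth f c₀) (hcN : c₀ ≤ N) (hN : 1 ≤ N) (ha : 0 < a) (hl : 1 ≤ l) (hb : 1 < b)
    (hbl : 1 ≤ l * Real.log b) (hal : -l ≤ Real.log a)
    (hlow : ∀ x : ℝ, 0 < x → x < 1 → a * b ^ diskPhi (x : ℂ) ≤ ‖f (x : ℂ)‖)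
    (hK : 2 ≤ K) (hlK : l ≤ K) (hd : 1 ≤ d) (hdK : d ≤ K) (hH : 1 ≤ H)
    (hHK : d * Real.log H ≤ K) (s : Finset ℂ) (hs : ↑s ⊆ diskAlgebraicPoints f K d H) :
    (s.card : ℝ) ≤ 10 ^ 19 * N ^ 7 * l ^ 2 * (d : ℝ) ^ 6 * K ^ 12 := by
  have hN0 : 0 < N := by linarith
  have hK0 : 0 < K := by linarith
  have hl0 : 0 < l := by linarith
  have hd1 : (1 : ℝ) ≤ d := by exact_mod_cast hd
  have hd0 : (0 : ℝ) < d := by linarith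
  set lam : ℝ := Real.log (2 * K) with hlam
  have hlam1 : 1 ≤ lam := one_le_log_two_mul hK
  have hlam0 : 0 < lam := by linarith
  have hlam2 : lam ^ 2 ≤ 8 * K := by linarith [log_sq_le_four_mul (by linarith : 1 ≤ 2 * K)]
  have hlamK : lam ≤ 2 * K := Real.log_le_self (by linarith)
  have hone : ∀ {x y : ℝ}, 1 ≤ x → 1 ≤ y → 1 ≤ x * y := fun hx hy =>
    one_le_mul_of_one_le_of_one_le hx hy
  -- the degree of the auxiliary polynomial
  obtain ⟨T, hT⟩ : ∃ T : ℕ, T = ⌈1212 * N * (d : ℝ) ^ 2 * K ^ 2 * lam⌉₊ := ⟨_, rfl⟩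
  have hW1 : 1 ≤ N * (d : ℝ) ^ 2 * K ^ 2 * lam :=
    hone (hone (hone hN (one_le_pow₀ hd1)) (one_le_pow₀ (by linarith))) hlam1
  have hTge : 1212 * N * (d : ℝ) ^ 2 * K ^ 2 * lam ≤ T := by rw [hT]; exact Nat.le_ceil _
  have hTle : (T : ℝ) ≤ 1213 * N * (d : ℝ) ^ 2 * K ^ 2 * lam := by
    have h1 : (T : ℝ) < 1212 * N * (d : ℝ) ^ 2 * K ^ 2 * lam + 1 := by
      rw [hT]; exact Nat.ceil_lt_add_one (by positivity)
    linarith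
  have hT1 : (1 : ℝ) ≤ T := by linarith
  have hT0 : (0 : ℝ) < T := by linarith
  obtain ⟨X, hX⟩ : ∃ X : ℝ, X = N * K * T * lam := ⟨_, rfl⟩
  have hXT : K * T ≤ X := by
    have : 1 * (K * T) ≤ (N * lam) * (K * T) := by gcongr; exact hone hN hlam1
    rw [hX]; linarith
  have hTX : (T : ℝ) ≤ X := by
    have : 1 * (T : ℝ) ≤ K * T := by gcongr; linarith
    linarith
  have hKX : K ≤ X := by
    have : K * 1 ≤ K * T := by gcongr
    linarith
  have hNT : N * T * lam ≤ X := by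
    have : 1 * (N * T * lam) ≤ K * (N * T * lam) := by gcongr; linarith
    rw [hX]; linarith
  have hlamX : lam ≤ X := by
    have : 1 * lam ≤ (N * T) * lam := by gcongr; exact hone hN hT1
    linarith
  have hX1 : 1 ≤ X := by linarith
  -- the size of its coefficients
  obtain ⟨B, hB⟩ : ∃ B : ℕ, B = ⌈Real.exp (9 * X)⌉₊ := ⟨_, rfl⟩
  have hBge : Real.exp (9 * X) ≤ B := by rw [hB]; exact Nat.le_ceil _
  have hBpos : (0 : ℝ) < B := (Real.exp_pos _).trans_le hBge
  have hBlog : Real.log B ≤ 10 * X := by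
    rw [Real.log_le_iff_le_exp hBpos]
    have h1 : (B : ℝ) < Real.exp (9 * X) + 1 := by
      rw [hB]; exact Nat.ceil_lt_add_one (Real.exp_pos _).le
    have h2 : 1 ≤ Real.exp (9 * X) := Real.one_le_exp (by linarith)
    have h3 : 2 ≤ Real.exp X := by linarith [Real.add_one_le_exp X]
    have h4 : Real.exp (10 * X) = Real.exp (9 * X) * Real.exp X := by
      rw [← Real.exp_add]; ring_nf
    rw [h4]
    nlinarith
  have hB1 : 1 ≤ B := by exact_mod_cast hBpos
  -- the number of Taylor coefficients
  obtain ⟨n, hn⟩ : ∃ n : ℕ, n = ⌈2 * K * (2 * d + 3) * (10 * X)⌉₊ := ⟨_, rfl⟩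
  have hnge : 2 * K * (2 * d + 3) * (10 * X) ≤ n := by rw [hn]; exact Nat.le_ceil _
  have hnle : (n : ℝ) ≤ 101 * d * K * X := by
    have h1 : (n : ℝ) < 2 * K * (2 * d + 3) * (10 * X) + 1 := by
      rw [hn]; exact Nat.ceil_lt_add_one (by positivity)
    have h2 : 2 * K * (2 * d + 3) * (10 * X) ≤ 2 * K * (5 * d) * (10 * X) := by gcongr; linarith
    have h3 : 1 ≤ d * K * X := hone (hone hd1 (by linarith)) hX1
    linarith
  have hnT : 2 * n * (2 * d + 3 + 1) ≤ (T + 1) ^ 2 := by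
    have h1 : (2 : ℝ) * n * (2 * d + 3 + 1) ≤ ((T : ℝ) + 1) ^ 2 := by
      calc (2 : ℝ) * n * (2 * d + 3 + 1) ≤ 2 * (101 * d * K * X) * (6 * d) := by
            gcongr; linarith
        _ = 1212 * N * (d : ℝ) ^ 2 * K ^ 2 * lam * T := by rw [hX]; ring
        _ ≤ T * T := by gcongr
        _ ≤ ((T : ℝ) + 1) ^ 2 := by nlinarith
    exact_mod_cast h1
  have hH0 : 0 < H := by linarith
  obtain ⟨p, hp0, hpB, hp⟩ := exists_bivariateEval_eq_zero hf hcN hK (d := d) (T := T) (B := B)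
    (n := n) hH (M := Real.exp (N * (2 * K) * Real.log (2 * K)))
    (Real.one_le_exp (by rw [← hlam]; positivity)) le_rfl (by
      rw [← hlam]
      exact (coefficient_size_le hK hlam hXT hTX hlamX hX1 hX hH0 hHK).trans hBge) (by
      rw [le_div_iff₀ (by positivity)]
      calc (2 * (d : ℝ) + 3) * Real.log B * (2 * K) ≤ (2 * d + 3) * (10 * X) * (2 * K) := by gcongr
        _ ≤ n := by linarith) hnT
  -- the point at which the polynomial is bounded below
  obtain ⟨m₀, hm₀⟩ : ∃ m₀ : ℕ, m₀ = ⌈40 * l * X⌉₊ := ⟨_, rfl⟩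
  have hm₀ge : 40 * l * X ≤ m₀ := by rw [hm₀]; exact Nat.le_ceil _
  have hlX : X ≤ l * X := by
    have : 1 * X ≤ l * X := by gcongr
    linarith
  have hmle : ∀ m : ℕ, m ≤ m₀ + T → (m : ℝ) ≤ 42 * l * X := by
    intro m hm
    have h1 : (m₀ : ℝ) < 40 * l * X + 1 := by
      rw [hm₀]; exact Nat.ceil_lt_add_one (by positivity)
    have h2 : (m : ℝ) ≤ m₀ + T := by exact_mod_cast hm
    linarith
  have hmge : ∀ m : ℕ, m₀ ≤ m → 40 * l * X ≤ m := fun m hm =>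
    hm₀ge.trans (by exact_mod_cast hm)
  have hlog : ∀ m : ℕ, m₀ ≤ m → m ≤ m₀ + T → Real.log (2 * m) ≤ 24 * N * lam := by
    intro m hm1 hm2
    have hm0 : (0 : ℝ) < m := lt_of_lt_of_le (by positivity) (hmge m hm1)
    rw [Real.log_le_iff_le_exp (by positivity)]
    have h1 : (T : ℝ) ≤ 2426 * N * K ^ 5 := by
      calc (T : ℝ) ≤ 1213 * N * (d : ℝ) ^ 2 * K ^ 2 * lam := hTle
        _ ≤ 1213 * N * K ^ 2 * K ^ 2 * (2 * K) := by gcongr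
        _ = _ := by ring
    have h2 : 2 * (m : ℝ) ≤ 407568 * N ^ 2 * K ^ 8 := by
      calc 2 * (m : ℝ) ≤ 2 * (42 * l * X) := by gcongr; exact hmle m hm2
        _ = 84 * l * (N * K * T * lam) := by rw [hX]; ring
        _ ≤ 84 * K * (N * K * (2426 * N * K ^ 5) * (2 * K)) := by gcongr
        _ = _ := by ring
    exact h2.trans (le_exp_of_param hN hK hlam)
  -- The terms add up to at most 1 + 2T + 10X + 24NTλ, and 1, T and NTλ are all at most X.
  have hG : ∀ m : ℕ, m₀ ≤ m → m ≤ m₀ + T →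
      Real.log (2 * ((T : ℝ) + 1) ^ 2 * B * (m : ℝ) ^ T) ≤ 37 * X := by
    intro m hm1 hm2
    have hm0 : (0 : ℝ) < m := lt_of_lt_of_le (by positivity) (hmge m hm1)
    have hTp : (0 : ℝ) < (T : ℝ) + 1 := by linarith
    rw [Real.log_mul (by positivity) (by positivity), Real.log_mul (by positivity) (by positivity),
      Real.log_mul (by positivity) (by positivity), Real.log_pow, Real.log_pow]
    have h1 : Real.log 2 ≤ 1 := by linarith [Real.log_two_lt_d9]
    have h2 : Real.log ((T : ℝ) + 1) ≤ T := by
      linarith [Real.log_le_sub_one_of_pos hTp]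
    have h3 : Real.log m ≤ 24 * N * lam :=
      (Real.log_le_log hm0 (by linarith)).trans (hlog m hm1 hm2)
    have h4 : (T : ℝ) * Real.log m ≤ T * (24 * N * lam) := by gcongr
    push_cast
    linarith
  obtain ⟨m, hm1, hm2, hcard⟩ := exists_card_zeros_bivariateEval_le hf hcN hN0.le ha hl0 hb hbl hal
    hlow hB1 hK (m₀ := m₀) (by linarith) (fun m hm1 hm2 => by
      refine (hG m hm1 hm2).trans ?_
      -- The slack between 37X and 40X pays for the term l, as l ≤ K ≤ X.
      have h1 : 40 * X ≤ m / l := by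
        rw [le_div_iff₀ hl0]
        linarith [hmge m hm1]
      linarith) hp0 hpB s (fun w hw => by
      obtain ⟨h1, h2, h3, h4, h5, h6⟩ := hs hw
      exact ⟨h1, hp w h1 h2 h3 h4 h5 h6⟩)
  exact card_bound_arith hN hK hT1 hl hlam1 hX (hmle m hm2) (by linarith [hmge m hm1])
    (hG m hm1 hm2) (hlog m hm1 hm2) hTle hlam2 hcard

theorem finite_and_ncard_le_of_forall_finset {α : Type*} {A : Set α} {C : ℝ}
    (h : ∀ s : Finset α, ↑s ⊆ A → (s.card : ℝ) ≤ C) : A.Finite ∧ (A.ncard : ℝ) ≤ C := by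
  have hfin : A.Finite := by
    by_contra hinf
    obtain ⟨s, hs, hcard⟩ := Set.Infinite.exists_subset_card_eq hinf (⌈C⌉₊ + 1)
    have h1 := h s hs
    have h2 := Nat.le_ceil C
    rw [hcard] at h1
    push_cast at h1
    linarith
  refine ⟨hfin, ?_⟩
  rw [Set.ncard_eq_toFinset_card A hfin]
  exact h _ (by simp)

theorem finite_and_ncard_diskAlgebraicPoints_le {f : ℂ → ℂ} {c₀ N a b l K H : ℝ} {d : ℕ}
    (hf : HasDiskGrowth f c₀) (hcN : c₀ ≤ N) (hN : 1 ≤ N) (ha : 0 < a) (hl : 1 ≤ l) (hb : 1 < b)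
    (hbl : 1 ≤ l * Real.log b) (hal : -l ≤ Real.log a)
    (hlow : ∀ x : ℝ, 0 < x → x < 1 → a * b ^ diskPhi (x : ℂ) ≤ ‖f (x : ℂ)‖)
    (hK : 2 ≤ K) (hlK : l ≤ K) (hd : 1 ≤ d) (hdK : d ≤ K) (hH : 1 ≤ H)
    (hHK : d * Real.log H ≤ K) : (diskAlgebraicPoints f K d H).Finite ∧
      ((diskAlgebraicPoints f K d H).ncard : ℝ) ≤
        10 ^ 19 * N ^ 7 * l ^ 2 * (d : ℝ) ^ 6 * K ^ 12 :=
  finite_and_ncard_le_of_forall_finset fun s hs =>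
    card_diskAlgebraicPoints_le hf hcN hN ha hl hb hbl hal hlow hK hlK hd hdK hH hHK s hs

/-! ### From the disk to the two counts. -/

/-- A point at which `f` is large and has small height stays away from the unit circle. -/
theorem norm_le_of_height_le {f : ℂ → ℂ} {a b l t K H : ℝ} {d : ℕ} {α : ℂ} (ha : 0 < a)
    (hb : 1 < b) (hl : 0 < l) (hbl : 1 ≤ l * Real.log b) (hat : -t ≤ Real.log a) (hH : 1 ≤ H)
    (hK : l * (d * Real.log H + t) ≤ K) (hα1 : ‖α‖ < 1) (hlow : a * b ^ diskPhi α ≤ ‖f α‖)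
    (hα : IsAlgebraic ℚ α) (hfα : IsAlgebraic ℚ (f α))
    (hd : Module.finrank ℚ (IntermediateField.adjoin ℚ ({α, f α} : Set ℂ)) ≤ d)
    (hHf : algHeight (f α) ≤ H) : ‖α‖ ≤ 1 - 1 / K := by
  have hH0 : 0 < H := by linarith
  have hphi0 : 0 < diskPhi α := by
    rw [diskPhi]; exact one_div_pos.2 (by linarith)
  have h1 : ‖f α‖ ≤ H ^ d :=
    norm_le_height_pow hfα ((natDegree_minpoly_right_le hα hfα).trans hd) hH hHf
  -- Logarithms give φ(α)·log b ≤ d·log H + t. Here t allows for a < 1: part (1) takes t = l and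
  -- part (2) takes t = 0.
  have h2 := Real.log_le_log (by positivity) (hlow.trans h1)
  rw [Real.log_mul ha.ne' (by positivity), Real.log_rpow (by linarith), Real.log_pow] at h2
  have h3 : diskPhi α ≤ K := by
    have h4 : diskPhi α * 1 ≤ diskPhi α * (l * Real.log b) := by gcongr
    have h5 : l * (diskPhi α * Real.log b) ≤ l * (d * Real.log H + t) := by
      gcongr; linarith
    nlinarith
  have h6 : 1 / K ≤ 1 / diskPhi α := one_div_le_one_div_of_le hphi0 h3
  rw [diskPhi, one_div_one_div] at h6
  linarith

theorem computable_const_mul_succ_pow (A k : ℕ) : Computable fun N : ℕ => A * (N + 1) ^ k := by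
  have hpow : Primrec fun N : ℕ => (N + 1) ^ k := by
    induction k with
    | zero => simpa using Primrec.const 1
    | succ k ih =>
      simp only [pow_succ]
      exact Primrec.nat_mul.comp ih Primrec.succ
  exact (Primrec.nat_mul.comp (Primrec.const A) hpow).to_comp

theorem finrank_adjoin_pair_rat (q r : ℚ) :
    Module.finrank ℚ (IntermediateField.adjoin ℚ ({(q : ℂ), (r : ℂ)} : Set ℂ)) = 1 := by
  have h : IntermediateField.adjoin ℚ ({(q : ℂ), (r : ℂ)} : Set ℂ) = ⊥ := by
    rw [IntermediateField.adjoin_eq_bot_iff]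
    rintro x (rfl | hx)
    · exact IntermediateField.mem_bot.2 ⟨q, by simp⟩
    · rw [Set.mem_singleton_iff.1 hx]
      exact IntermediateField.mem_bot.2 ⟨r, by simp⟩
  rw [h]
  exact IntermediateField.finrank_bot

theorem finite_and_ncard_rationalPoints_le {f : ℂ → ℂ} {a b c₀ : ℝ} {N : ℕ} (ha : 0 < a)
    (hb : 1 < b) (hc₀ : 0 < c₀) (haN : 1 ≤ N * a) (hbN : 1 ≤ N * (b - 1)) (hcN : c₀ ≤ N)
    (hf : HasDiskGrowth f c₀)
    (hlow : ∀ x : ℝ, 0 < x → x < 1 → a * b ^ diskPhi (x : ℂ) ≤ ‖f (x : ℂ)‖) {H : ℝ}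
    (hH : Real.exp 1 ≤ H) :
    (rationalPoints f H).Finite ∧ ((rationalPoints f H).ncard : ℝ) ≤
      (10 ^ 19 * 4096 * (N + 1) ^ 33 : ℕ) * Real.log H ^ 18 := by
  have hN : (1 : ℝ) ≤ N := by
    have : (0 : ℝ) < N := hc₀.trans_le hcN
    exact_mod_cast this
  have hH0 : 0 < H := (Real.exp_pos 1).trans_le hH
  have hL : 1 ≤ Real.log H := (Real.le_log_iff_exp_le hH0).2 hH
  have hH1 : 1 ≤ H := (Real.one_le_exp zero_le_one).trans hH
  obtain ⟨L, hLdef⟩ : ∃ L, L = Real.log H := ⟨_, rfl⟩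
  -- The choice N + 1 instead of N matters: log b ≥ (b - 1)/b, and (N + 1)(b - 1) ≥ 1 + (b - 1) = b.
  -- For a, log a ≥ 1 - 1/a ≥ 1 - N.
  obtain ⟨l, hl⟩ : ∃ l : ℝ, l = N + 1 := ⟨_, rfl⟩
  have hl2 : 2 ≤ l := by linarith
  have hbl : 1 ≤ l * Real.log b := by
    have h1 := Real.one_sub_inv_le_log_of_pos (by linarith : 0 < b)
    have h2 : 1 ≤ l * (1 - b⁻¹) := by
      have h3 : l * (1 - b⁻¹) = l * (b - 1) / b := by field_simp
      rw [h3, le_div_iff₀ (by linarith)]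
      linarith [hl ▸ (by ring : ((N : ℝ) + 1) * (b - 1) = N * (b - 1) + (b - 1))]
    have h3 : l * (1 - b⁻¹) ≤ l * Real.log b := by gcongr
    linarith
  have hal : -l ≤ Real.log a := by
    have h1 := Real.one_sub_inv_le_log_of_pos ha
    have h2 : a⁻¹ ≤ N := by
      rw [inv_le_iff_one_le_mul₀ ha]
      exact haN
    linarith
  rw [← hLdef] at hL ⊢
  -- The points lie in the disk as soon as K ≥ l(L + l), and 2l²L suffices because l and L are at
  -- least 1.
  obtain ⟨K, hK⟩ : ∃ K : ℝ, K = 2 * l ^ 2 * L := ⟨_, rfl⟩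
  have h1 : l * L ≤ l * l * L := by
    have : l * 1 * L ≤ l * l * L := by gcongr; linarith
    linarith
  have h2 : l * l ≤ l * l * L := by
    have : l * l * 1 ≤ l * l * L := by gcongr
    linarith
  have h3 : l ≤ l * l := by nlinarith
  have h4 : L ≤ l * L := by nlinarith
  have hKl : K = l * l * L + l * l * L := by rw [hK]; ring
  obtain ⟨hfin, hcard⟩ := finite_and_ncard_diskAlgebraicPoints_le (K := K) (H := H) (d := 1) hf
    hcN hN ha (by linarith) hb hbl hal hlow (by linarith) (by linarith) le_rfl
    (by push_cast; linarith) hH1 (by rw [← hLdef]; push_cast; linarith)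
  have hsub : (fun q : ℚ => (q : ℂ)) '' rationalPoints f H ⊆ diskAlgebraicPoints f K 1 H := by
    rintro _ ⟨q, ⟨hq0, hq1, hHq, r, hr, hHr⟩, rfl⟩
    have hq0' : (0 : ℝ) < q := by exact_mod_cast hq0
    have hq1' : (q : ℝ) < 1 := by exact_mod_cast hq1
    have hqc : (((q : ℝ)) : ℂ) = (q : ℂ) := by push_cast; rfl
    have hqlow := hlow q hq0' hq1'
    rw [hqc] at hqlow
    have hqn : ‖(q : ℂ)‖ < 1 := by
      rw [← hqc, Complex.norm_real, Real.norm_eq_abs, abs_of_pos hq0']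
      exact hq1'
    have halg : IsAlgebraic ℚ (f q) := by rw [hr]; exact isAlgebraic_ratCast ℚ r
    have hdeg : Module.finrank ℚ (IntermediateField.adjoin ℚ ({(q : ℂ), f q} : Set ℂ)) ≤ 1 := by
      rw [hr]; exact (finrank_adjoin_pair_rat q r).le
    have hHf : algHeight (f q) ≤ H := by rw [hr]; exact hHr
    exact ⟨norm_le_of_height_le ha hb (by linarith) hbl hal hH1
      (by rw [← hLdef]; push_cast; linarith) hqn hqlow (isAlgebraic_ratCast ℚ q) halg hdeg hHf,
      (isAlgebraic_ratCast ℚ q), halg, hdeg, hHq, hHf⟩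
  have hinj : Function.Injective fun q : ℚ => (q : ℂ) := Rat.cast_injective
  refine ⟨(hfin.subset hsub).of_finite_image hinj.injOn, ?_⟩
  rw [← Set.ncard_image_of_injective _ hinj]
  have h5 : ((Set.ncard ((fun q : ℚ => (q : ℂ)) '' rationalPoints f H) : ℕ) : ℝ) ≤
      (diskAlgebraicPoints f K 1 H).ncard := by
    exact_mod_cast Set.ncard_le_ncard hsub hfin
  refine h5.trans (hcard.trans ?_)
  have hl0 : 0 < l := by linarith
  -- The factor 4096 = 2^12 comes from K^12, and N ≤ l turns N^7·l^26 into at most (N + 1)^33.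
  calc 10 ^ 19 * (N : ℝ) ^ 7 * l ^ 2 * ((1 : ℕ) : ℝ) ^ 6 * K ^ 12
      = 10 ^ 19 * 4096 * (N : ℝ) ^ 7 * l ^ 26 * L ^ 12 := by rw [hK]; push_cast; ring
    _ ≤ 10 ^ 19 * 4096 * l ^ 7 * l ^ 26 * L ^ 18 := by
        gcongr
        · linarith
        · norm_num
    _ = _ := by rw [hl]; push_cast; ring

theorem finite_and_ncard_algebraicPoints_le {f : ℂ → ℂ} {S : Set ℂ} {a b c₀ : ℝ} {N : ℕ}
    (hb : 1 < b) (hc₀ : 0 < c₀) (hcN : c₀ ≤ N) (hab : max (b ^ Real.exp 1) (Real.exp 1) ≤ a)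
    (hS : S ⊆ Metric.ball 0 1) (hIS : ∀ x : ℝ, 0 < x → x < 1 → (x : ℂ) ∈ S)
    (hf : HasDiskGrowth f c₀) (hlow : ∀ z ∈ S, a * b ^ diskPhi z ≤ ‖f z‖) {d : ℕ} {H : ℝ}
    (hd : 2 ≤ d) (hH : Real.exp (Real.exp 1) ≤ H) :
    (algebraicPoints f S d H).Finite ∧ ((algebraicPoints f S d H).ncard : ℝ) ≤
      (10 ^ 19 * 512 * (N + 1) ^ 7 : ℕ) * (Real.log a / Real.log b) ^ 17 *
        Real.log (Real.log a / Real.log b) ^ 9 * (d : ℝ) ^ 18 * Real.log d ^ 9 *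
        Real.log H ^ 17 * Real.log (Real.log H) ^ 6 := by
  have hN : (1 : ℝ) ≤ N := by
    have : (0 : ℝ) < N := hc₀.trans_le hcN
    exact_mod_cast this
  have he1 : 1 ≤ Real.exp 1 := Real.one_le_exp zero_le_one
  have hH0 : 0 < H := (Real.exp_pos _).trans_le hH
  have hLe : Real.exp 1 ≤ Real.log H := (Real.le_log_iff_exp_le hH0).2 hH
  have hLL : 1 ≤ Real.log (Real.log H) :=
    (Real.le_log_iff_exp_le ((Real.exp_pos 1).trans_le hLe)).2 hLe
  have hH1 : 1 ≤ H := (Real.one_le_exp (Real.exp_pos 1).le).trans hH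
  have ha0 : 0 < a := (Real.exp_pos 1).trans_le ((le_max_right _ _).trans hab)
  have hla : 1 ≤ Real.log a := (Real.le_log_iff_exp_le ha0).2 ((le_max_right _ _).trans hab)
  have hlb : 0 < Real.log b := Real.log_pos hb
  obtain ⟨l, hl⟩ : ∃ l, l = Real.log a / Real.log b := ⟨_, rfl⟩
  -- This is the use of a ≥ b^e: it makes log l ≥ 1, just as H ≥ e^e makes log log H ≥ 1, so these
  -- factors can be inserted freely.
  have hle : Real.exp 1 ≤ l := by
    rw [hl, le_div_iff₀ hlb, ← Real.log_rpow (by linarith)]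
    exact Real.log_le_log (by positivity) ((le_max_left _ _).trans hab)
  have hll : 1 ≤ Real.log l := (Real.le_log_iff_exp_le ((Real.exp_pos 1).trans_le hle)).2 hle
  have hbl : l * Real.log b = Real.log a := by rw [hl]; field_simp
  obtain ⟨L, hLdef⟩ : ∃ L, L = Real.log H := ⟨_, rfl⟩
  rw [← hl, ← hLdef]
  rw [← hLdef] at hLe hLL
  have hl1 : 1 ≤ l := he1.trans hle
  have hL1 : 1 ≤ L := he1.trans hLe
  have hd2 : (2 : ℝ) ≤ d := by exact_mod_cast hd
  -- No allowance for a is needed since log a ≥ 1. Then d^6·K^12 contributes d^18·l^12·L^12.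
  obtain ⟨K, hK⟩ : ∃ K, K = l * (d * L) := ⟨_, rfl⟩
  have h1 : d * L ≤ K := by
    have : 1 * (d * L) ≤ l * (d * L) := by gcongr
    linarith
  have h2 : (d : ℝ) ≤ d * L := by
    have : (d : ℝ) * 1 ≤ d * L := by gcongr
    linarith
  have h3 : l ≤ K := by
    have : l * 1 ≤ l * (d * L) := by gcongr; linarith
    linarith
  obtain ⟨hfin, hcard⟩ := finite_and_ncard_diskAlgebraicPoints_le (K := K) (H := H) (d := d) hf
    hcN hN ha0 hl1 hb (by linarith) (by linarith) (fun x hx0 hx1 => hlow _ (hIS x hx0 hx1))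
    (by linarith) h3 (by omega) (by linarith) hH1 (by rw [← hLdef]; exact h1)
  have hsub : algebraicPoints f S d H ⊆ diskAlgebraicPoints f K d H := by
    rintro α ⟨hαS, hα, hfα, hdeg, hHα, hHf⟩
    exact ⟨norm_le_of_height_le (t := 0) (l := l) ha0 hb (by linarith) (by linarith) (by linarith) hH1
      (by rw [← hLdef, add_zero, hK]) (by simpa using hS hαS) (hlow α hαS) hα hfα hdeg hHf,
      hα, hfα, hdeg, hHα, hHf⟩
  refine ⟨hfin.subset hsub, ?_⟩
  have h5 : ((algebraicPoints f S d H).ncard : ℝ) ≤ (diskAlgebraicPoints f K d H).ncard := by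
    exact_mod_cast Set.ncard_le_ncard hsub hfin
  refine h5.trans (hcard.trans ?_)
  -- For d = 2 the factor log d is below 1. It exceeds 1/2, so 512 = 2^9 compensates for its ninth
  -- power.
  have hld : 1 ≤ 512 * Real.log d ^ 9 := by
    have h6 : 1 / 2 ≤ Real.log d := by
      have := Real.log_le_log two_pos hd2
      linarith [Real.log_two_gt_d9]
    calc (1 : ℝ) = 512 * (1 / 2) ^ 9 := by norm_num
      _ ≤ _ := by gcongr
  have hl17 : l ^ 14 ≤ l ^ 17 * Real.log l ^ 9 := by
    calc l ^ 14 = l ^ 14 * 1 := (mul_one _).symm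
      _ ≤ l ^ 17 * Real.log l ^ 9 := by
        gcongr
        · norm_num
        · exact one_le_pow₀ hll
  have hL17 : L ^ 12 ≤ L ^ 17 * Real.log L ^ 6 := by
    calc L ^ 12 = L ^ 12 * 1 := (mul_one _).symm
      _ ≤ L ^ 17 * Real.log L ^ 6 := by
        gcongr
        · norm_num
        · exact one_le_pow₀ hLL
  have hl0 : 0 < l := by linarith
  have hL0 : 0 < L := by linarith
  calc 10 ^ 19 * (N : ℝ) ^ 7 * l ^ 2 * (d : ℝ) ^ 6 * K ^ 12
      = 10 ^ 19 * (N : ℝ) ^ 7 * l ^ 14 * (d : ℝ) ^ 18 * 1 * L ^ 12 := by rw [hK]; ring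
    _ ≤ 10 ^ 19 * ((N : ℝ) + 1) ^ 7 * (l ^ 17 * Real.log l ^ 9) * (d : ℝ) ^ 18 *
        (512 * Real.log d ^ 9) * (L ^ 17 * Real.log L ^ 6) := by
        gcongr
        linarith
    _ = _ := by push_cast; ring

theorem mainTheorem6 :
    (∃ C : ℕ → ℕ, Computable C ∧ ∀ N : ℕ, 0 < C N ∧
      ∀ (f : ℂ → ℂ) (a b c₀ : ℝ), 0 < a → 1 < b → 0 < c₀ →
        1 ≤ N * a → 1 ≤ N * (b - 1) → c₀ ≤ N →
        HasDiskGrowth f c₀ →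
        (∀ x : ℝ, 0 < x → x < 1 → a * b ^ diskPhi (x : ℂ) ≤ ‖f (x : ℂ)‖) →
        ∀ H : ℝ, Real.exp 1 ≤ H →
          (rationalPoints f H).Finite ∧
          ((rationalPoints f H).ncard : ℝ) ≤ C N * Real.log H ^ 18) ∧
    (∃ C : ℕ → ℕ, Computable C ∧ ∀ N : ℕ, 0 < C N ∧
      ∀ (f : ℂ → ℂ) (S : Set ℂ) (a b c₀ : ℝ), 1 < b → 0 < c₀ → c₀ ≤ N →
        max (b ^ Real.exp 1) (Real.exp 1) ≤ a →
        S ⊆ Metric.ball 0 1 →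
        (∀ x : ℝ, 0 < x → x < 1 → (x : ℂ) ∈ S) →
        HasDiskGrowth f c₀ →
        (∀ z ∈ S, a * b ^ diskPhi z ≤ ‖f z‖) →
        ∀ (d : ℕ) (H : ℝ), 2 ≤ d → Real.exp (Real.exp 1) ≤ H →
          (algebraicPoints f S d H).Finite ∧
          ((algebraicPoints f S d H).ncard : ℝ) ≤
            C N * (Real.log a / Real.log b) ^ 17 *
              Real.log (Real.log a / Real.log b) ^ 9 *
              (d : ℝ) ^ 18 * Real.log d ^ 9 *
              Real.log H ^ 17 * Real.log (Real.log H) ^ 6) := by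
  refine ⟨⟨fun N => 10 ^ 19 * 4096 * (N + 1) ^ 33, computable_const_mul_succ_pow _ _, fun N =>
    ⟨by positivity, ?_⟩⟩, ⟨fun N => 10 ^ 19 * 512 * (N + 1) ^ 7,
    computable_const_mul_succ_pow _ _, fun N => ⟨by positivity, ?_⟩⟩⟩
  · intro f a b c₀ ha hb hc₀ haN hbN hcN hf hlow H hH
    exact finite_and_ncard_rationalPoints_le ha hb hc₀ haN hbN hcN hf hlow hH
  · intro f S a b c₀ hb hc₀ hcN hab hS hIS hf hlow d H hd hH
    exact finite_and_ncard_algebraicPoints_le hb hc₀ hcN hab hS hIS hf hlow hd hH
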